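/- Let $R$ be a commutative ring. A graded quiver $Q$ consists of a set of objects and a $\mathbb Z$-graded $R$-module $Q(x,y)$ for each pair of objects. A formal morphism $F:Q_1\to Q_2$ is a map $F^0$ on objects together with graded $R$-linear maps $F^n:Q_1(x_{n-1},x_n)\otimes\cdots\otimes Q_1(x_0,x_1)\to Q_2(F^0x_0,F^0x_n)[1-n]$, $n\ge 1$; formal morphisms compose by $(G\cdot F)^n(f_n,\dots,f_1)=\sum_{i_1+\dots+i_r=n,\ i_j\ge 1}G^r(F^{i_r}(f_n,\dots),\dots,F^{i_1}(\dots,f_1))$. An $A_\infty$-category (not assumed unital, possibly curved) is a graded quiver with graded maps $m^n:Q(x_{n-1},x_n)\otimes\cdots\otimes Q(x_0,x_1)\to Q(x_0,x_n)[2-n]$, $n\ge 0$, such that, for all composable homogeneous $f_1,\dots,f_n$, $n\ge0$, $$\sum_{m,d\ge0,\ m+d\le n}(-1)^{\dagger_d}m^{n-m+1}\big(f_n,\dots,f_{d+m+1},m^m(f_{d+m},\dots,f_{d+1}),f_d,\dots,f_1\big)=0,\qquad \dagger_d=\deg f_1+\dots+\deg f_d-d.$$ It is flat if $m^0=0$.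 An $A_\infty$-functor $F$ is a formal morphism with $$\sum_{r,\ i_1+\dots+i_r=n,\ i_j\ge1}m^r\big(F^{i_r}(f_n,\dots),\dots,F^{i_1}(\dots,f_1)\big)=\sum_{m,d\ge 0,\ m+d\le n}(-1)^{\dagger_d}F^{n-m+1}\big(f_n,\dots,m^m(f_{d+m},\dots,f_{d+1}),f_d,\dots,f_1\big)$$ for all $n\ge 0$. A strict unit at an object $x$ is an element $1_x$ of degree $0$ such that $m^n(\dots,1_x,\dots)=0$ for all $n\ne2$, and $m^2(f,1_x)=f$, $m^2(1_x,f)=(-1)^{\deg f}f$ whenever defined; an $A_\infty$-category is strictly unital if every object has a strict unit, and an $A_\infty$-functor between strictly unital $A_\infty$-categories is strictly unital if $F^1(1_x)=1_{F^0x}$ and $F^n(\dots,1_x,\dots)=0$ for $n\ge2$. An $A_\infty$-functor $F:\mathscr A\to\mathscr B$ satisfies (F1) if for all objects $x,y$ the map $F^1:\mathscr A(x,y)\to\mathscr B(F^0x,F^0y)$ is a surjection that splits in the category of graded $R$-modules. **Theorem B.** Let $F:\mathscr A\to\mathscr A'$ be an $A_\infty$-functor satisfying (F1) and let $G:\mathscr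 A''\to\mathscr A'$ be any $A_\infty$-functor. Then the diagram $\mathscr A\xrightarrow{F}\mathscr A'\xleftarrow{G}\mathscr A''$ has a pullback $(\mathscr P,\ \alpha:\mathscr P\to\mathscr A'',\ \beta:\mathscr P\to\mathscr A)$ in the category of $A_\infty$-categories and $A_\infty$-functors, and for every such pullback $\alpha$ satisfies (F1). More precisely, let $K(x_1,x_2)=\ker\big(F^1:\mathscr A(x_1,x_2)\to\mathscr A'(F^0x_1,F^0x_2)\big)$ and let $(K\times\mathscr A'')_{S'}$ be the graded quiver whose objects are the pairs $(x,y)$ of objects of $\mathscr A$ and $\mathscr A''$ with $F^0x=G^0y$, with morphisms $K(x_1,x_2)\oplus\mathscr A''(y_1,y_2)$ from $(x_1,y_1)$ to $(x_2,y_2)$. Then there is an $A_\infty$-structure on $(K\times\mathscr A'')_{S'}$, giving $\mathscr P$, and there is $\beta$ with $\beta^0(x,y)=x$ such that, with $\alpha$ the projection to $\mathscr A''$ (so $\alpha^n=0$ for $n\ge2$), $(\mathscr P,\alpha,\beta)$ is a pullback as above. If $\mathscr A$ and $\mathscr A''$ are flat, so is $\mathscr P$. If $\mathscr A,\mathscr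 A',\mathscr A''$, $F$ and $G$ are strictly unital, then so are $\mathscr P$, $\alpha$ and $\beta$, and $(\mathscr P,\alpha,\beta)$ is also a pullback in the category of strictly unital $A_\infty$-categories and strictly unital $A_\infty$-functors. -/

import Mathlib

open CategoryTheory

universe w u v

namespace AInfinity

/-- A graded quiver over `R`: a type of objects and, for all objects `x`, `y`, a `ℤ`-graded
`R`-module `Hom x y`, the direct sum of its homogeneous parts `deg x y d`. -/
structure GradedQuiver (R : Type w) [CommRing R] where
  Obj : Type u
  Hom : Obj → Obj → Type v
  [addCommGroup : ∀ x y, AddCommGroup (Hom x y)]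
  [module : ∀ x y, Module R (Hom x y)]
  deg : ∀ x y, ℤ → Submodule R (Hom x y)
  isInternal : ∀ x y, DirectSum.IsInternal (deg x y)

attribute [instance] GradedQuiver.addCommGroup GradedQuiver.module

/-- Chains of composable morphisms are Mathlib's paths: the path
`nil.cons f₁ |>.cons f₂ … |>.cons fₙ` is the argument list written `(fₙ, …, f₁)`. -/
instance {R : Type w} [CommRing R] (Q : GradedQuiver.{w, u, v} R) : Quiver Q.Obj := ⟨Q.Hom⟩

open Quiver (Path)

section Chains

variable {R : Type w} [CommRing R] {Q : GradedQuiver.{w, u, v} R}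

/-- A function on the chains from `x` to `y` is multilinear if it is `R`-linear in each morphism of
the chain; that is, a linear map on each tensor product
`Q(xₙ₋₁, xₙ) ⊗ … ⊗ Q(x₀, x₁)` with `x₀ = x`, `xₙ = y`. -/
def IsMultilinear {x y : Q.Obj} {M : Type*} [AddCommGroup M] [Module R M]
    (φ : Path x y → M) : Prop :=
  ∀ (a b : Q.Obj) (p : Path x a) (q : Path b y),
    IsLinearMap R (fun f : Q.Hom a b => φ ((p.cons f).comp q))

/-- `HasDeg p d`: all morphisms `f₁, …, fₙ` of the chain `p` can be given degrees with
`(deg f₁ - 1) + … + (deg fₙ - 1) = d`. -/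
def HasDeg {x : Q.Obj} : ∀ {y : Q.Obj}, Path x y → ℤ → Prop
  | _, Path.nil, d => d = 0
  | _, Path.cons (b := y) (c := z) p f, d =>
      ∃ e : ℤ, f ∈ Q.deg y z e ∧ HasDeg p (d - (e - 1))

/-- The linear involution of `Q(x, y)` which is `f ↦ (-1) ^ (deg f - 1) f` on homogeneous
elements. -/
noncomputable def koszul (Q : GradedQuiver.{w, u, v} R) (x y : Q.Obj) :
    Q.Hom x y →ₗ[R] Q.Hom x y :=
  DirectSum.toModule R ℤ (Q.Hom x y)
      (fun d => ((d - 1).negOnePow : ℤ) • (Q.deg x y d).subtype) ∘ₗ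
    (LinearEquiv.ofBijective (DirectSum.coeLinearMap (Q.deg x y)) (Q.isInternal x y)).symm

/-- `koszul` applied to every morphism of a chain; on a chain of homogeneous elements `f₁, …, f_d`
this contributes the sign `(-1) ^ (deg f₁ + … + deg f_d - d)`. -/
noncomputable def koszulPath {x : Q.Obj} : ∀ {y : Q.Obj}, Path x y → Path x y
  | _, Path.nil => Path.nil
  | _, Path.cons (b := y) (c := z) p f => (koszulPath p).cons (koszul Q y z f)

/-- All ways of writing a chain as a chain followed by a chain (possibly empty). -/
def splits {x : Q.Obj} : ∀ {y : Q.Obj}, Path x y → List (Σ z : Q.Obj, Path x z × Path z y)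
  | _, Path.nil => [⟨x, Path.nil, Path.nil⟩]
  | _, Path.cons (c := z) p f =>
      ⟨z, p.cons f, Path.nil⟩ :: (splits p).map (fun s => ⟨s.1, s.2.1, s.2.2.cons f⟩)

/-- The terms `± (fₙ, …, f_{d+m+1}, D(f_{d+m}, …, f_{d+1}), f_d, …, f₁)`, `0 ≤ m`, `d + m ≤ n`,
of the coderivation of the bar construction defined by `D`, with the sign
`(-1) ^ (deg f₁ + … + deg f_d - d)`; the term with `m = 0` inserts the element `D()`. -/
noncomputable def insertions (D : ∀ {x y : Q.Obj}, Path x y → Q.Hom x y) {x y : Q.Obj}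
    (p : Path x y) : List (Path x y) :=
  (splits p).flatMap fun s =>
    (splits s.2.2).map fun t => ((koszulPath s.2.1).cons (D t.2.1)).comp t.2.2

end Chains

section Formal

variable {R : Type w} [CommRing R]

/-- A formal morphism of graded quivers: a map on objects and multilinear maps `Fⁿ`, `n ≥ 1`, of
degree `1 - n` on chains of length `n`. All `Fⁿ` are collected in one function on chains, which is
`0` on empty chains by convention. -/
structure FormalMorphism (Q₁ Q₂ : GradedQuiver.{w, u, v} R) where
  obj : Q₁.Obj → Q₂.Obj
  map : ∀ {x y : Q₁.Obj}, Path x y → Q₂.Hom (obj x) (obj y)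
  map_nil : ∀ x : Q₁.Obj, map (Path.nil : Path x x) = 0
  multilinear : ∀ x y : Q₁.Obj, IsMultilinear (map : Path x y → Q₂.Hom (obj x) (obj y))
  map_mem : ∀ {x y : Q₁.Obj} (p : Path x y) (d : ℤ), HasDeg p d →
    map p ∈ Q₂.deg (obj x) (obj y) (d + 1)

variable {Q₁ Q₂ Q₃ Q₄ : GradedQuiver.{w, u, v} R}

/-- All chains `(F(b_r), …, F(b_1))`, where `b_1, …, b_r` are the blocks of a partition of the
chain `p` followed by `q` into consecutive nonempty blocks, `q` being part of the last block
(`q` itself is nonempty). -/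
def blocksAux (F : FormalMorphism Q₁ Q₂) {x : Q₁.Obj} :
    ∀ {y z : Q₁.Obj}, Path x y → Path y z → List (Path (F.obj x) (F.obj z))
  | _, _, Path.nil, q => [Path.nil.cons (F.map q)]
  | _, _, Path.cons p f, q =>
      blocksAux F p ((Path.nil.cons f).comp q) ++
        (blocksAux F p (Path.nil.cons f)).map (fun c => c.cons (F.map q))

/-- All chains `(F(b_r), …, F(b_1))`, where `b_1, …, b_r` are the blocks of a partition of the
chain `p` into consecutive nonempty blocks; the sum of these chains is the image of `p` under the
cofunctor of bar constructions defined by `F`. -/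
def blocks (F : FormalMorphism Q₁ Q₂) {x : Q₁.Obj} :
    ∀ {y : Q₁.Obj}, Path x y → List (Path (F.obj x) (F.obj y))
  | _, Path.nil => [Path.nil]
  | _, Path.cons p f => blocksAux F p (Path.nil.cons f)

end Formal

/-! ### Basic facts, needed for the categories below -/

section Lemmas

variable {R : Type w} [CommRing R] {Q Q₁ Q₂ Q₃ Q₄ : GradedQuiver.{w, u, v} R}

theorem koszul_of_mem {x y : Q.Obj} {f : Q.Hom x y} {d : ℤ} (hf : f ∈ Q.deg x y d) :
    koszul Q x y f = ((d - 1).negOnePow : ℤ) • f := by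
  have h : (LinearEquiv.ofBijective (DirectSum.coeLinearMap (Q.deg x y)) (Q.isInternal x y)).symm f
      = DirectSum.lof R ℤ (fun d => Q.deg x y d) d ⟨f, hf⟩ := by
    rw [LinearEquiv.symm_apply_eq]
    exact (DirectSum.coeLinearMap_lof (Q.deg x y) d ⟨f, hf⟩).symm
  simp only [koszul, LinearMap.comp_apply, LinearEquiv.coe_coe, h, DirectSum.toModule_lof]
  simp

theorem IsMultilinear.cons {x y z : Q.Obj} {M : Type*} [AddCommGroup M] [Module R M]
    {φ : Path x z → M} (hφ : IsMultilinear φ) (g : Q.Hom y z) :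
    IsMultilinear (fun p : Path x y => φ (p.cons g)) :=
  fun a b p q => hφ a b p (q.cons g)

theorem IsMultilinear.last {x y z : Q.Obj} {M : Type*} [AddCommGroup M] [Module R M]
    {φ : Path x z → M} (hφ : IsMultilinear φ) (p : Path x y) :
    IsLinearMap R (fun g : Q.Hom y z => φ (p.cons g)) :=
  hφ y z p Path.nil

theorem isLinearMap_sum {ι : Type*} {M N : Type*} [AddCommGroup M] [Module R M] [AddCommGroup N]
    [Module R N] (l : List ι) (f : ι → M → N) (h : ∀ i, IsLinearMap R (f i)) :
    IsLinearMap R (fun m => (l.map (fun i => f i m)).sum) := by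
  induction l with
  | nil => exact ⟨by simp, by simp⟩
  | cons i l ih =>
    refine ⟨fun a b => ?_, fun c a => ?_⟩
    · have := ih.map_add a b
      simp only [List.map_cons, List.sum_cons, (h i).map_add, this]
      abel
    · have := ih.map_smul c a
      simp only [List.map_cons, List.sum_cons, (h i).map_smul, this, smul_add]

theorem isLinearMap_add' {M N : Type*} [AddCommGroup M] [Module R M] [AddCommGroup N]
    [Module R N] {f g : M → N} (hf : IsLinearMap R f) (hg : IsLinearMap R g) :
    IsLinearMap R (fun m => f m + g m) :=
  ⟨fun a b => by rw [hf.map_add, hg.map_add]; abel,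
    fun c a => by rw [hf.map_smul, hg.map_smul, smul_add]⟩

theorem isLinearMap_list_sum {M N : Type*} [AddCommGroup M] [Module R M] [AddCommGroup N]
    [Module R N] {f : M → N} (hf : IsLinearMap R f) {ι : Type*} (l : List ι) (g : ι → M) :
    f (l.map g).sum = (l.map (fun i => f (g i))).sum := by
  induction l with
  | nil => simpa using hf.map_zero
  | cons i l ih => simp [hf.map_add, ih]

/-- Sums over lists can be interchanged. -/
theorem sum_comm {ι κ M : Type*} [AddCommMonoid M] (l : List ι) (m : List κ) (f : ι → κ → M) :
    (l.map (fun i => (m.map (fun j => f i j)).sum)).sum =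
      (m.map (fun j => (l.map (fun i => f i j)).sum)).sum := by
  induction l with
  | nil => simp
  | cons i l ih => simp [ih, List.sum_map_add]

theorem sum_flatMap {ι κ M : Type*} [AddCommMonoid M] (l : List ι) (g : ι → List κ) (f : κ → M) :
    ((l.flatMap g).map f).sum = (l.map (fun i => ((g i).map f).sum)).sum := by
  induction l with
  | nil => simp
  | cons i l ih => simp [ih]

/-! #### Degrees -/

theorem HasDeg.comp {x y z : Q.Obj} {p : Path x y} {q : Path y z} {d e : ℤ}
    (hp : HasDeg p d) (hq : HasDeg q e) : HasDeg (p.comp q) (d + e) := by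
  induction q generalizing e with
  | nil => simp only [HasDeg] at hq; subst hq; simpa using hp
  | cons q f ih =>
    obtain ⟨k, hk, h⟩ := hq
    refine ⟨k, hk, ?_⟩
    have := ih h
    rwa [show d + e - (k - 1) = d + (e - (k - 1)) by ring]

theorem hasDeg_single {x y : Q.Obj} {f : Q.Hom x y} {d : ℤ} (hf : f ∈ Q.deg x y d) :
    HasDeg (Path.nil.cons f : Path x y) (d - 1) :=
  ⟨d, hf, by simp [HasDeg]⟩

theorem hasDeg_blocksAux (F : FormalMorphism Q₁ Q₂) {x y z : Q₁.Obj} (p : Path x y) (q : Path y z)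
    {d e : ℤ} (hp : HasDeg p d) (hq : HasDeg q e) (c) (hc : c ∈ blocksAux F p q) :
    HasDeg c (d + e) := by
  induction p generalizing z d e with
  | nil =>
    simp only [HasDeg] at hp
    simp only [blocksAux, List.mem_singleton] at hc
    subst hp hc
    exact ⟨e + 1, F.map_mem q e hq, by simp [HasDeg]⟩
  | cons p f ih =>
    obtain ⟨k, hk, h⟩ := hp
    simp only [blocksAux, List.mem_append, List.mem_map] at hc
    rcases hc with hc | ⟨c, hc, rfl⟩
    · have := ih _ h ((hasDeg_single hk).comp hq) c hc
      rwa [show d - (k - 1) + (k - 1 + e) = d + e by ring] at this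
    · have := ih _ h (hasDeg_single hk) c hc
      refine ⟨e + 1, F.map_mem q e hq, ?_⟩
      rwa [show d + e - (e + 1 - 1) = d - (k - 1) + (k - 1) by ring]

theorem hasDeg_blocks (F : FormalMorphism Q₁ Q₂) {x y : Q₁.Obj} (p : Path x y)
    {d : ℤ} (hp : HasDeg p d) (c) (hc : c ∈ blocks F p) : HasDeg c d := by
  cases p with
  | nil =>
    simp only [blocks, List.mem_singleton] at hc
    subst hc
    exact hp
  | cons p f =>
    obtain ⟨k, hk, h⟩ := hp
    have := hasDeg_blocksAux F p _ h (hasDeg_single hk) c hc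
    rwa [show d - (k - 1) + (k - 1) = d by ring] at this

/-! #### Multilinearity -/

theorem blocksAux_linear (F : FormalMorphism Q₁ Q₂) {M : Type*} [AddCommGroup M] [Module R M]
    {x y a b z : Q₁.Obj} (p : Path x y) (r : Path y a) (s : Path b z)
    (φ : Path (F.obj x) (F.obj z) → M) (hφ : IsMultilinear φ) :
    IsLinearMap R (fun f : Q₁.Hom a b =>
      ((blocksAux F p ((r.cons f).comp s)).map φ).sum) := by
  induction p with
  | nil =>
    have h1 := F.multilinear _ _ a b r s
    have h2 := hφ.last Path.nil
    refine ⟨fun f g => ?_, fun c f => ?_⟩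
    · have := h1.map_add f g
      simp only [blocksAux, List.map_cons, List.map_nil, List.sum_cons, List.sum_nil, add_zero]
      rw [this, h2.map_add]
    · have := h1.map_smul c f
      simp only [blocksAux, List.map_cons, List.map_nil, List.sum_cons, List.sum_nil, add_zero]
      rw [this, h2.map_smul]
  | cons p f' ih =>
    have h1 := ih ((Path.nil.cons f').comp r)
    have h2 : IsLinearMap R (fun f : Q₁.Hom a b =>
        ((blocksAux F p (Path.nil.cons f')).map
          (fun c => φ (c.cons (F.map ((r.cons f).comp s))))).sum) := by
      refine isLinearMap_sum _ _ fun c => ?_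
      have h1 := F.multilinear _ _ a b r s
      have h2 := hφ.last c
      refine ⟨fun f g => ?_, fun k f => ?_⟩
      · have := h1.map_add f g
        simp only [this, h2.map_add]
      · have := h1.map_smul k f
        simp only [this, h2.map_smul]
    have h3 := isLinearMap_add' h1 h2
    simp only [blocksAux, List.map_append, List.sum_append, List.map_map, Function.comp_def]
    simpa only [← Path.comp_assoc, Path.comp_cons] using h3

theorem blocksAux_linear' (F : FormalMorphism Q₁ Q₂) {M : Type*} [AddCommGroup M] [Module R M]
    {x a b y z : Q₁.Obj} (p : Path x a) (q : Path b y) (r : Path y z)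
    (φ : Path (F.obj x) (F.obj z) → M) (hφ : IsMultilinear φ) :
    IsLinearMap R (fun f : Q₁.Hom a b =>
      ((blocksAux F ((p.cons f).comp q) r).map φ).sum) := by
  induction q generalizing z with
  | nil =>
    have h1 := blocksAux_linear F p Path.nil r φ hφ
    have h2 := blocksAux_linear F p Path.nil Path.nil _ (hφ.cons (F.map r))
    have h3 := isLinearMap_add' h1 h2
    simpa only [Path.comp_nil, blocksAux, List.map_append, List.sum_append, List.map_map,
      Function.comp_def] using h3
  | cons q g ih =>
    have h3 := isLinearMap_add' (ih ((Path.nil.cons g).comp r) φ hφ)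
      (ih (Path.nil.cons g) _ (hφ.cons (F.map r)))
    simpa only [Path.comp_cons, blocksAux, List.map_append, List.sum_append, List.map_map,
      Function.comp_def] using h3

theorem blocks_linear (F : FormalMorphism Q₁ Q₂) {M : Type*} [AddCommGroup M] [Module R M]
    {x y : Q₁.Obj} {φ : Path (F.obj x) (F.obj y) → M} (hφ : IsMultilinear φ) :
    IsMultilinear (fun p : Path x y => ((blocks F p).map φ).sum) := by
  intro a b p q
  cases q with
  | nil => exact blocksAux_linear F p Path.nil Path.nil φ hφ
  | cons q g => exact blocksAux_linear' F p q (Path.nil.cons g) φ hφ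

end Lemmas

section Composition

variable {R : Type w} [CommRing R] {Q Q₁ Q₂ Q₃ Q₄ : GradedQuiver.{w, u, v} R}

/-- The composition `G · F` of formal morphisms:
`(G · F)ⁿ(fₙ, …, f₁) = ∑ Gʳ(F(block r), …, F(block 1))`, the sum over all partitions of
`(fₙ, …, f₁)` into consecutive nonempty blocks. -/
@[reducible] def FormalMorphism.comp (F : FormalMorphism Q₁ Q₂) (G : FormalMorphism Q₂ Q₃) :
    FormalMorphism Q₁ Q₃ where
  obj x := G.obj (F.obj x)
  map p := ((blocks F p).map G.map).sum
  map_nil x := by simp [blocks, G.map_nil]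
  multilinear x y := blocks_linear F (G.multilinear _ _)
  map_mem p d hp := by
    refine list_sum_mem fun g hg => ?_
    obtain ⟨c, hc, rfl⟩ := List.mem_map.1 hg
    exact G.map_mem c d (hasDeg_blocks F p hp c hc)

/-- The values of the formal morphism with linear part `f` and no higher components. -/
def strictMap {obj : Q₁.Obj → Q₂.Obj}
    (f : ∀ x y : Q₁.Obj, Q₁.Hom x y →ₗ[R] Q₂.Hom (obj x) (obj y)) {x : Q₁.Obj} :
    ∀ {y : Q₁.Obj}, Path x y → Q₂.Hom (obj x) (obj y)
  | _, Path.nil => 0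
  | y, Path.cons Path.nil g => f x y g
  | _, Path.cons (Path.cons _ _) _ => 0

/-- A functor of graded quivers (a map on objects and degree preserving linear maps on morphisms)
as a formal morphism with `Fⁿ = 0` for `n ≥ 2`. -/
@[reducible] def FormalMorphism.strict (obj : Q₁.Obj → Q₂.Obj)
    (f : ∀ x y : Q₁.Obj, Q₁.Hom x y →ₗ[R] Q₂.Hom (obj x) (obj y))
    (hf : ∀ (x y : Q₁.Obj) (d : ℤ) (g : Q₁.Hom x y), g ∈ Q₁.deg x y d →
      f x y g ∈ Q₂.deg (obj x) (obj y) d) : FormalMorphism Q₁ Q₂ where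
  obj := obj
  map p := strictMap f p
  map_nil x := rfl
  multilinear x y a b p q := by
    cases q with
    | nil =>
      cases p with
      | nil => exact (f x y).isLinear
      | cons p g => exact (0 : Q₁.Hom a y →ₗ[R] _).isLinear
    | cons q g =>
      cases q with
      | nil => exact (0 : Q₁.Hom a b →ₗ[R] _).isLinear
      | cons q g => exact (0 : Q₁.Hom a b →ₗ[R] _).isLinear
  map_mem {x y} p d hp := by
    cases p with
    | nil => exact Submodule.zero_mem _
    | cons p g =>
      cases p with
      | nil =>
        obtain ⟨e, he, h⟩ := hp
        have h : d - (e - 1) = 0 := h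
        obtain rfl : e = d + 1 := by omega
        exact hf _ _ _ _ he
      | cons p g => exact Submodule.zero_mem _

/-- The identity of a graded quiver. -/
@[reducible] def FormalMorphism.id (Q : GradedQuiver.{w, u, v} R) : FormalMorphism Q Q :=
  FormalMorphism.strict (fun x => x) (fun _ _ => LinearMap.id) (fun _ _ _ _ h => h)

/-- The linear part `F¹ : Q₁(x, y) → Q₂(F x, F y)` of a formal morphism. -/
def FormalMorphism.lin (F : FormalMorphism Q₁ Q₂) (x y : Q₁.Obj) :
    Q₁.Hom x y →ₗ[R] Q₂.Hom (F.obj x) (F.obj y) :=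
  IsLinearMap.mk' (fun f => F.map (Path.nil.cons f)) (F.multilinear x y x y Path.nil Path.nil)

theorem FormalMorphism.lin_mem (F : FormalMorphism Q₁ Q₂) {x y : Q₁.Obj} {d : ℤ} {f : Q₁.Hom x y}
    (hf : f ∈ Q₁.deg x y d) : F.lin x y f ∈ Q₂.deg _ _ d := by
  have := F.map_mem _ _ (hasDeg_single hf)
  rwa [sub_add_cancel] at this

/-! #### Composition is unital and associative -/

theorem sum_blocksAux_id_of_two {M : Type*} [AddCommGroup M] [Module R M] {x y z a b : Q.Obj}
    (p : Path x y) (q : Path y a) (g : Q.Hom a b) (h : Q.Hom b z)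
    (φ : Path x z → M) (hφ : IsMultilinear φ) :
    ((blocksAux (FormalMorphism.id Q) p ((q.cons g).cons h)).map φ).sum = 0 := by
  induction p with
  | nil =>
    simp only [blocksAux, List.map_cons, List.map_nil, List.sum_cons, List.sum_nil, add_zero]
    exact (hφ.last Path.nil).map_zero
  | cons p f ih =>
    have h1 := ih ((Path.nil.cons f).comp q)
    simp only [blocksAux, List.map_append, List.sum_append, List.map_map, Path.comp_cons] at h1 ⊢
    rw [h1, zero_add]
    refine List.sum_eq_zero fun m hm => ?_
    obtain ⟨c, -, rfl⟩ := List.mem_map.1 hm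
    exact (hφ.last c).map_zero

theorem sum_blocksAux_id {M : Type*} [AddCommGroup M] [Module R M] {x y z : Q.Obj}
    (p : Path x y) (g : Q.Hom y z) (φ : Path x z → M) (hφ : IsMultilinear φ) :
    ((blocksAux (FormalMorphism.id Q) p (Path.nil.cons g)).map φ).sum = φ (p.cons g) := by
  induction p generalizing z with
  | nil =>
    simp only [blocksAux, List.map_cons, List.map_nil, List.sum_cons, List.sum_nil, add_zero]
    rfl
  | cons p f ih =>
    simp only [blocksAux, List.map_append, List.sum_append, List.map_map, Path.comp_cons,
      Path.comp_nil]
    rw [sum_blocksAux_id_of_two p Path.nil f g φ hφ, zero_add]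
    exact ih f _ (hφ.cons g)

theorem sum_blocks_id {M : Type*} [AddCommGroup M] [Module R M] {x y : Q.Obj}
    (p : Path x y) (φ : Path x y → M) (hφ : IsMultilinear φ) :
    ((blocks (FormalMorphism.id Q) p).map φ).sum = φ p := by
  cases p with
  | nil =>
    simp only [blocks, List.map_cons, List.map_nil, List.sum_cons, List.sum_nil, add_zero]
  | cons p g => exact sum_blocksAux_id p g φ hφ

theorem blocksAux_pos (F : FormalMorphism Q₁ Q₂) {x y z : Q₁.Obj} (p : Path x y) (q : Path y z)
    (c) (hc : c ∈ blocksAux F p q) :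
    ∃ (w : Q₂.Obj) (c' : Path (F.obj x) w) (g : Q₂.Hom w (F.obj z)), c = c'.cons g := by
  induction p generalizing z with
  | nil =>
    simp only [blocksAux, List.mem_singleton] at hc
    exact ⟨_, _, _, hc⟩
  | cons p f ih =>
    simp only [blocksAux, List.mem_append, List.mem_map] at hc
    rcases hc with hc | ⟨c, hc, rfl⟩
    · exact ih _ c hc
    · exact ⟨_, _, _, rfl⟩

theorem sum_blocksAux_strict (F : FormalMorphism Q₁ Q₂) {x y z : Q₁.Obj} (p : Path x y)
    (q : Path y z) :
    ((blocksAux F p q).map (FormalMorphism.id Q₂).map).sum = F.map (p.comp q) := by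
  induction p generalizing z with
  | nil =>
    simp only [blocksAux, List.map_cons, List.map_nil, List.sum_cons, List.sum_nil, add_zero,
      Path.nil_comp]
    rfl
  | cons p f ih =>
    simp only [blocksAux, List.map_append, List.sum_append, List.map_map, ih]
    rw [List.sum_eq_zero, add_zero]
    · rw [← Path.comp_assoc]; rfl
    · intro m hm
      obtain ⟨c, hc, rfl⟩ := List.mem_map.1 hm
      obtain ⟨w, c', g, rfl⟩ := blocksAux_pos F _ _ c hc
      rfl

theorem FormalMorphism.ext_map {F G : FormalMorphism Q₁ Q₂} (h : F.obj = G.obj)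
    (h' : ∀ {x y : Q₁.Obj} (p : Path x y), F.map p ≍ G.map p) : F = G := by
  obtain ⟨o, m, _, _, _⟩ := F
  obtain ⟨o', m', _, _, _⟩ := G
  obtain rfl : o = o' := h
  obtain rfl : @m = @m' := by
    funext x y p
    exact eq_of_heq (h' p)
  rfl

theorem FormalMorphism.comp_id (F : FormalMorphism Q₁ Q₂) : F.comp (FormalMorphism.id Q₂) = F := by
  refine FormalMorphism.ext_map rfl fun {x y} p => heq_of_eq ?_
  cases p with
  | nil => exact ((F.comp (FormalMorphism.id Q₂)).map_nil x).trans (F.map_nil x).symm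
  | cons p f => exact sum_blocksAux_strict F p (Path.nil.cons f)

theorem FormalMorphism.id_comp (F : FormalMorphism Q₁ Q₂) : (FormalMorphism.id Q₁).comp F = F :=
  FormalMorphism.ext_map rfl fun p => heq_of_eq (sum_blocks_id p F.map (F.multilinear _ _))

/-- Cutting a chain twice. -/
theorem splits_coassoc {M : Type*} [AddCommMonoid M] {x y : Q.Obj} (p : Path x y)
    (θ : ∀ {a b : Q.Obj}, Path x a → Path a b → Path b y → M) :
    ((splits p).map fun s => ((splits s.2.2).map fun t => θ s.2.1 t.2.1 t.2.2).sum).sum =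
      ((splits p).map fun s => ((splits s.2.1).map fun t => θ t.2.1 t.2.2 s.2.2).sum).sum := by
  induction p with
  | nil => simp [splits]
  | cons p f ih =>
    have := ih (fun p q r => θ p q (r.cons f))
    simp only [splits, List.map_cons, List.map_map, List.sum_cons, Function.comp_def,
      List.map_nil, List.sum_nil, add_zero, List.sum_map_add] at this ⊢
    rw [this, add_assoc]

/-- Cutting a chain with a marked morphism. -/
theorem splits_marked {M : Type*} [AddCommMonoid M] {x a b y : Q.Obj} (p : Path x a) (g : Q.Hom a b)
    (q : Path b y) (θ : ∀ {z : Q.Obj}, Path x z → Path z y → M) :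
    ((splits ((p.cons g).comp q)).map fun s => θ s.2.1 s.2.2).sum =
      ((splits q).map fun s => θ ((p.cons g).comp s.2.1) s.2.2).sum +
      ((splits p).map fun s => θ s.2.1 ((s.2.2.cons g).comp q)).sum := by
  induction q with
  | nil => simp [splits, Function.comp_def]
  | cons q f ih =>
    have := ih (fun p q => θ p (q.cons f))
    simp only [Path.comp_cons, splits, List.map_cons, List.map_map, List.sum_cons,
      Function.comp_def] at this ⊢
    rw [this, add_assoc]

theorem splits_length {x y : Q.Obj} (p : Path x y) (s) (hs : s ∈ splits p) :
    s.2.1.length ≤ p.length := by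
  induction p with
  | nil =>
    simp only [splits, List.mem_singleton] at hs
    subst hs; rfl
  | cons p f ih =>
    simp only [splits, List.mem_cons, List.mem_map] at hs
    rcases hs with rfl | ⟨s, hs, rfl⟩
    · rfl
    · exact (ih s hs).trans (Nat.le_succ _)

theorem sum_blocksAux_last (F : FormalMorphism Q₁ Q₂) {M : Type*} [AddCommMonoid M]
    {x y z : Q₁.Obj} (p : Path x y) (q : Path y z) (φ : Path (F.obj x) (F.obj z) → M) :
    ((blocksAux F p q).map φ).sum = ((splits p).map fun s =>
      ((blocks F s.2.1).map fun c => φ (c.cons (F.map (s.2.2.comp q)))).sum).sum := by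
  induction p generalizing z with
  | nil => simp [splits, blocks, blocksAux]
  | cons p f ih =>
    simp only [splits, blocksAux, List.map_append, List.sum_append, List.map_cons, List.sum_cons,
      List.map_map, Function.comp_def, ih ((Path.nil.cons f).comp q) φ, blocks, Path.nil_comp]
    rw [add_comm]
    congr 1
    simp only [← Path.comp_assoc, Path.comp_cons, Path.comp_nil]

/-- The last block of a partition of a nonempty chain. -/
theorem sum_blocks_cons (F : FormalMorphism Q₁ Q₂) {M : Type*} [AddCommMonoid M]
    {x y z : Q₁.Obj} (p : Path x y) (f : Q₁.Hom y z) (φ : Path (F.obj x) (F.obj z) → M) :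
    ((blocks F (p.cons f)).map φ).sum = ((splits p).map fun s =>
      ((blocks F s.2.1).map fun c => φ (c.cons (F.map (s.2.2.cons f)))).sum).sum :=
  sum_blocksAux_last F p (Path.nil.cons f) φ

theorem sum_blocks_last_nil (F : FormalMorphism Q₁ Q₂) {M : Type*} [AddCommGroup M] [Module R M]
    {x y : Q₁.Obj} (l : List (Path (F.obj x) (F.obj y)))
    {φ : Path (F.obj x) (F.obj y) → M} (hφ : IsMultilinear φ) :
    (l.map fun c => φ (c.cons (F.map (Path.nil : Path y y)))).sum = 0 := by
  refine List.sum_eq_zero fun m hm => ?_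
  obtain ⟨c, -, rfl⟩ := List.mem_map.1 hm
  rw [F.map_nil]
  exact (hφ.last c).map_zero

theorem sum_blocks_cons' (F : FormalMorphism Q₁ Q₂) {M : Type*} [AddCommGroup M] [Module R M]
    {x y z : Q₁.Obj} (p : Path x y) (f : Q₁.Hom y z)
    {φ : Path (F.obj x) (F.obj z) → M} (hφ : IsMultilinear φ) :
    ((blocks F (p.cons f)).map φ).sum = ((splits (p.cons f)).map fun s =>
      ((blocks F s.2.1).map fun c => φ (c.cons (F.map s.2.2))).sum).sum := by
  rw [sum_blocks_cons]
  simp only [splits, List.map_cons, List.sum_cons, List.map_map, Function.comp_def]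
  rw [sum_blocks_last_nil F _ hφ, zero_add]

theorem sum_blocksAux_splits (F : FormalMorphism Q₁ Q₂) {M : Type*} [AddCommMonoid M]
    {x y z : Q₁.Obj} (p : Path x y) (q : Path y z)
    (θ : ∀ {a : Q₂.Obj}, Path (F.obj x) a → Path a (F.obj z) → M) :
    ((blocksAux F p q).map fun c => ((splits c).map fun s => θ s.2.1 s.2.2).sum).sum =
      ((splits p).map fun s => ((blocks F s.2.1).map fun c =>
        ((blocksAux F s.2.2 q).map fun d => θ c d).sum).sum).sum +
      ((blocksAux F p q).map fun c => θ c Path.nil).sum := by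
  induction p generalizing z with
  | nil => simp [splits, blocks, blocksAux, add_comm]
  | cons p f ih =>
    have h1 := ih ((Path.nil.cons f).comp q) θ
    have h2 := ih (Path.nil.cons f) (fun c d => θ c (d.cons (F.map q)))
    simp only [splits, blocks, blocksAux, List.map_append, List.sum_append, List.map_cons,
      List.sum_cons, List.map_map, Function.comp_def, List.map_nil, List.sum_nil, add_zero,
      List.sum_map_add] at h1 h2 ⊢
    rw [h1, h2]
    abel

/-- `blocks` is compatible with cutting chains. -/
theorem sum_blocks_splits (F : FormalMorphism Q₁ Q₂) {M : Type*} [AddCommMonoid M]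
    {x y : Q₁.Obj} (p : Path x y) (θ : ∀ {a : Q₂.Obj}, Path (F.obj x) a → Path a (F.obj y) → M) :
    ((blocks F p).map fun c => ((splits c).map fun s => θ s.2.1 s.2.2).sum).sum =
      ((splits p).map fun s => ((blocks F s.2.1).map fun c =>
        ((blocks F s.2.2).map fun d => θ c d).sum).sum).sum := by
  cases p with
  | nil => simp [splits, blocks]
  | cons p f =>
    have := sum_blocksAux_splits F p (Path.nil.cons f) θ
    simp only [splits, blocks, List.map_cons, List.sum_cons, List.map_map, Function.comp_def,
      List.map_nil, List.sum_nil, add_zero] at this ⊢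
    rw [this, add_comm]

theorem sum_blocks_comp (F : FormalMorphism Q₁ Q₂) (G : FormalMorphism Q₂ Q₃) {M : Type*}
    [AddCommGroup M] [Module R M] {x y : Q₁.Obj} (p : Path x y)
    (φ : Path (G.obj (F.obj x)) (G.obj (F.obj y)) → M) (hφ : IsMultilinear φ) :
    ((blocks (F.comp G) p).map φ).sum =
      ((blocks F p).map fun c => ((blocks G c).map φ).sum).sum := by
  induction hn : p.length using Nat.strong_induction_on generalizing y with
  | _ n ih =>
  cases p with
  | nil =>
    simp only [blocks, List.map_cons, List.map_nil, List.sum_cons, List.sum_nil, add_zero]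
  | cons p f =>
    have hR : ((blocks F (p.cons f)).map fun c => ((blocks G c).map φ).sum) =
        (blocks F (p.cons f)).map fun c => ((splits c).map fun s =>
          ((blocks G s.2.1).map fun e => φ (e.cons (G.map s.2.2))).sum).sum := by
      refine List.map_congr_left fun c hc => ?_
      obtain ⟨w, c', g, rfl⟩ := blocksAux_pos F _ _ c hc
      exact sum_blocks_cons' G c' g hφ
    rw [hR, sum_blocks_splits F (p.cons f) (fun c d =>
      ((blocks G c).map fun e => φ (e.cons (G.map d))).sum)]
    refine (sum_blocks_cons (F.comp G) p f φ).trans ?_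
    simp only [splits, List.map_cons, List.sum_cons, List.map_map, Function.comp_def]
    have h0 : ((blocks F (p.cons f)).map fun c => ((blocks F (Path.nil : Path y y)).map fun d =>
        ((blocks G c).map fun e => φ (e.cons (G.map d))).sum).sum).sum = 0 := by
      refine List.sum_eq_zero fun m hm => ?_
      obtain ⟨c, -, rfl⟩ := List.mem_map.1 hm
      simp only [blocks, List.map_cons, List.map_nil, List.sum_cons, List.sum_nil, add_zero]
      exact sum_blocks_last_nil G _ hφ
    rw [h0, zero_add]
    congr 1
    refine List.map_congr_left fun s hs => ?_
    have hl := splits_length p s hs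
    have h1 : ∀ e : Path (G.obj (F.obj x)) (G.obj (F.obj s.1)),
        φ (e.cons ((F.comp G).map (s.2.2.cons f))) =
        ((blocks F (s.2.2.cons f)).map fun d => φ (e.cons (G.map d))).sum := fun e =>
      isLinearMap_list_sum (hφ.last e) _ _
    have h2 := ih s.2.1.length (by rw [← hn]; exact Nat.lt_succ_of_le hl) s.2.1
      (fun e => φ (e.cons ((F.comp G).map (s.2.2.cons f)))) (hφ.cons _) rfl
    refine h2.trans ?_
    congr 1
    refine List.map_congr_left fun c _ => ?_
    simp only [h1]
    exact sum_comm _ _ _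

theorem FormalMorphism.comp_assoc (F : FormalMorphism Q₁ Q₂) (G : FormalMorphism Q₂ Q₃)
    (H : FormalMorphism Q₃ Q₄) : (F.comp G).comp H = F.comp (G.comp H) :=
  FormalMorphism.ext_map rfl fun p =>
    heq_of_eq (sum_blocks_comp F G p H.map (H.multilinear _ _))

/-! #### Signs -/

theorem koszulPath_comp {x y z : Q.Obj} (p : Path x y) (q : Path y z) :
    koszulPath (p.comp q) = (koszulPath p).comp (koszulPath q) := by
  induction q with
  | nil => rfl
  | cons q f ih => simp only [Path.comp_cons, koszulPath, ih]

theorem splits_koszulPath {x y : Q.Obj} (p : Path x y) :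
    splits (koszulPath p) =
      (splits p).map fun s => ⟨s.1, koszulPath s.2.1, koszulPath s.2.2⟩ := by
  induction p with
  | nil => rfl
  | cons p f ih => simp [splits, koszulPath, ih, Function.comp_def]

theorem map_koszulPath_of_hasDeg {M : Type*} [AddCommGroup M] [Module R M] {x y : Q.Obj}
    (p : Path x y) (d : ℤ) (hp : HasDeg p d) (φ : Path x y → M) (hφ : IsMultilinear φ) :
    φ (koszulPath p) = (d.negOnePow : ℤ) • φ p := by
  induction p generalizing d with
  | nil =>
    simp only [HasDeg] at hp
    subst hp
    simp [koszulPath]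
  | cons p f ih =>
    rename_i a b
    obtain ⟨e, he, h⟩ := hp
    have h1 : ∀ (c : Path x a) (g : Q.Hom a b) (k : ℤ), φ (c.cons (k • g)) = k • φ (c.cons g) :=
      fun c g k => map_zsmul (IsLinearMap.mk' _ (hφ.last c)) k g
    simp only [koszulPath, koszul_of_mem he, h1, ih _ h _ (hφ.cons f)]
    rw [smul_smul, ← Units.val_mul, ← Int.negOnePow_add]
    congr 3
    ring

theorem multilinear_ext_aux {M : Type*} [AddCommGroup M] [Module R M] {x y z : Q.Obj}
    (p : Path x y) (q : Path y z) (e : ℤ) (hq : HasDeg q e) (φ ψ : Path x z → M)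
    (hφ : IsMultilinear φ) (hψ : IsMultilinear ψ)
    (h : ∀ (r : Path x z) (d : ℤ), HasDeg r d → φ r = ψ r) : φ (p.comp q) = ψ (p.comp q) := by
  induction p generalizing e with
  | nil =>
    rw [Path.nil_comp]
    exact h q e hq
  | cons p f ih =>
    rename_i b c
    have hf : f ∈ ⨆ d, Q.deg b c d := by
      rw [(Q.isInternal b c).submodule_iSup_eq_top]
      trivial
    induction hf using Submodule.iSup_induction' with
    | mem d f hf =>
      have := ih ((Path.nil.cons f).comp q) _ ((hasDeg_single hf).comp hq)
      rwa [← Path.comp_assoc] at this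
    | zero => exact (hφ b c p q).map_zero.trans (hψ b c p q).map_zero.symm
    | add f g _ _ hf hg =>
      refine ((hφ b c p q).map_add f g).trans (Eq.trans ?_ ((hψ b c p q).map_add f g).symm)
      rw [hf, hg]

theorem multilinear_ext {M : Type*} [AddCommGroup M] [Module R M] {x y : Q.Obj}
    {φ ψ : Path x y → M} (hφ : IsMultilinear φ) (hψ : IsMultilinear ψ)
    (h : ∀ (r : Path x y) (d : ℤ), HasDeg r d → φ r = ψ r) (p : Path x y) : φ p = ψ p :=
  multilinear_ext_aux p Path.nil 0 rfl φ ψ hφ hψ h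

theorem FormalMorphism.map_koszulPath (F : FormalMorphism Q₁ Q₂) {x y : Q₁.Obj} (p : Path x y) :
    F.map (koszulPath p) = koszul Q₂ _ _ (F.map p) := by
  refine multilinear_ext (φ := fun p => F.map (koszulPath p))
    (ψ := fun p => koszul Q₂ _ _ (F.map p)) ?_ ?_ ?_ p
  · intro a b p q
    have h := F.multilinear x y a b (koszulPath p) (koszulPath q)
    refine ⟨fun f g => ?_, fun k f => ?_⟩
    · simp only [koszulPath_comp, koszulPath, map_add]
      exact h.map_add _ _
    · simp only [koszulPath_comp, koszulPath, map_smul]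
      exact h.map_smul _ _
  · intro a b p q
    have h := F.multilinear x y a b p q
    refine ⟨fun f g => ?_, fun k f => ?_⟩
    · have := h.map_add f g
      simp only at this ⊢
      rw [this, map_add]
    · have := h.map_smul k f
      simp only at this ⊢
      rw [this, map_smul]
  · intro r d hr
    have h := map_koszulPath_of_hasDeg r d hr F.map (F.multilinear x y)
    simp only [h, koszul_of_mem (F.map_mem r d hr), add_sub_cancel_right]

theorem blocksAux_koszulPath (F : FormalMorphism Q₁ Q₂) {x y z : Q₁.Obj} (p : Path x y)
    (q : Path y z) :
    blocksAux F (koszulPath p) (koszulPath q) = (blocksAux F p q).map koszulPath := by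
  induction p generalizing z with
  | nil => simp [koszulPath, blocksAux, F.map_koszulPath]
  | cons p f ih =>
    have h1 := ih ((Path.nil.cons f).comp q)
    have h2 := ih (Path.nil.cons f)
    rw [koszulPath_comp] at h1
    simp only [koszulPath, blocksAux] at h1 h2 ⊢
    simp [h1, h2, F.map_koszulPath, koszulPath, Function.comp_def]

theorem blocks_koszulPath (F : FormalMorphism Q₁ Q₂) {x y : Q₁.Obj} (p : Path x y) :
    blocks F (koszulPath p) = (blocks F p).map koszulPath := by
  cases p with
  | nil => rfl
  | cons p f => exact blocksAux_koszulPath F p (Path.nil.cons f)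

theorem sum_insertions (D : ∀ {x y : Q.Obj}, Path x y → Q.Hom x y) {M : Type*} [AddCommMonoid M]
    {x y : Q.Obj} (p : Path x y) (φ : Path x y → M) :
    ((insertions D p).map φ).sum = ((splits p).map fun s => ((splits s.2.2).map fun t =>
      φ (((koszulPath s.2.1).cons (D t.2.1)).comp t.2.2)).sum).sum := by
  simp only [insertions, sum_flatMap, List.map_map, Function.comp_def]

theorem sum_insertions_cons (D : ∀ {x y : Q.Obj}, Path x y → Q.Hom x y) {M : Type*}
    [AddCommMonoid M] {x y z : Q.Obj} (p : Path x y) (f : Q.Hom y z) (φ : Path x z → M) :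
    ((insertions D (p.cons f)).map φ).sum =
      ((insertions D p).map fun c => φ (c.cons f)).sum +
      ((splits (p.cons f)).map fun s => φ ((koszulPath s.2.1).cons (D s.2.2))).sum := by
  simp only [sum_insertions, splits, List.map_cons, List.sum_cons, List.map_map,
    Function.comp_def, List.map_nil, List.sum_nil, add_zero, List.sum_map_add, Path.comp_nil,
    Path.comp_cons]
  ac_rfl

end Composition

/-! ### A∞-categories and A∞-functors -/

section AInfinityCategories

variable {R : Type w} [CommRing R]

/-- An A∞-structure on a graded quiver `Q`: multilinear maps `Dⁿ`, `n ≥ 0`, of degree `2 - n` on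
chains of length `n` (collected in one function on chains, so that the curvature `D⁰(x)` is the
value on the empty chain at `x`), such that
`∑ (-1) ^ (deg f₁ + … + deg f_d - d) D(fₙ, …, D(f_{d+m}, …, f_{d+1}), f_d, …, f₁) = 0`. -/
structure AInfStructure (Q : GradedQuiver.{w, u, v} R) where
  map : ∀ {x y : Q.Obj}, Path x y → Q.Hom x y
  multilinear : ∀ x y : Q.Obj, IsMultilinear (map : Path x y → Q.Hom x y)
  map_mem : ∀ {x y : Q.Obj} (p : Path x y) (d : ℤ), HasDeg p d → map p ∈ Q.deg x y (d + 2)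
  sq_zero : ∀ {x y : Q.Obj} (p : Path x y), ((insertions map p).map map).sum = 0

/-- `F` is an A∞-functor from `(Q₁, D₁)` to `(Q₂, D₂)`:
`∑ ± F(fₙ, …, D₁(f_{d+m}, …, f_{d+1}), f_d, …, f₁) = ∑ D₂(F(block r), …, F(block 1))`
for all chains `(fₙ, …, f₁)`, `n ≥ 0`, with the signs of `insertions`. -/
def IsAInfFunctor {Q₁ Q₂ : GradedQuiver.{w, u, v} R} (D₁ : AInfStructure Q₁)
    (D₂ : AInfStructure Q₂) (F : FormalMorphism Q₁ Q₂) : Prop :=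
  ∀ (x y : Q₁.Obj) (p : Path x y),
    ((insertions D₁.map p).map F.map).sum = ((blocks F p).map D₂.map).sum

/-- An A∞-category over `R`, possibly non-unital and curved. -/
structure AInfCat (R : Type w) [CommRing R] where
  quiver : GradedQuiver.{w, u, v} R
  str : AInfStructure quiver

/-- An A∞-functor. -/
structure AInfFunctor (A B : AInfCat.{w, u, v} R) where
  toFormal : FormalMorphism A.quiver B.quiver
  isAInf : IsAInfFunctor A.str B.str toFormal

theorem AInfStructure.insertions_ne_nil {Q : GradedQuiver.{w, u, v} R}
    (D : ∀ {x y : Q.Obj}, Path x y → Q.Hom x y) {Q' : GradedQuiver.{w, u, v} R}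
    (F : FormalMorphism Q Q') {M : Type*} [AddCommGroup M] [Module R M] {x y : Q.Obj}
    (p : Path x y) {φ : Path (F.obj x) (F.obj y) → M} (hφ : IsMultilinear φ) :
    ((insertions D p).map fun q => ((blocks F q).map φ).sum).sum =
    ((insertions D p).map fun q => ((splits q).map fun s =>
      ((blocks F s.2.1).map fun c => φ (c.cons (F.map s.2.2))).sum).sum).sum := by
  congr 1
  refine List.map_congr_left fun q hq => ?_
  simp only [insertions, List.mem_flatMap, List.mem_map] at hq
  obtain ⟨s, -, ⟨z, t, r⟩, -, rfl⟩ := hq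
  cases r with
  | nil => exact sum_blocks_cons' F _ _ hφ
  | cons r g => exact sum_blocks_cons' F _ _ hφ

/-- An A∞-functor intertwines the coderivations of the bar constructions. -/
theorem IsAInfFunctor.sum_comm {Q₁ Q₂ : GradedQuiver.{w, u, v} R} {D₁ : AInfStructure Q₁}
    {D₂ : AInfStructure Q₂} {F : FormalMorphism Q₁ Q₂} (hF : IsAInfFunctor D₁ D₂ F)
    {M : Type*} [AddCommGroup M] [Module R M] {x y : Q₁.Obj} (p : Path x y)
    (φ : Path (F.obj x) (F.obj y) → M) (hφ : IsMultilinear φ) :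
    ((insertions D₁.map p).map fun q => ((blocks F q).map φ).sum).sum =
      ((blocks F p).map fun c => ((insertions D₂.map c).map φ).sum).sum := by
  induction hn : p.length using Nat.strong_induction_on generalizing y with
  | _ n ih =>
  have key : ((insertions D₁.map p).map fun q => ((blocks F q).map φ).sum).sum =
      ((splits p).map fun s => ((insertions D₁.map s.2.1).map fun q =>
        ((blocks F q).map fun c => φ (c.cons (F.map s.2.2))).sum).sum).sum +
      ((blocks F p).map fun c => ((splits c).map fun s =>
        φ ((koszulPath s.2.1).cons (D₂.map s.2.2))).sum).sum := by
    rw [AInfStructure.insertions_ne_nil D₁.map F p hφ, sum_insertions]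
    have hm : ∀ (s : Σ z : Q₁.Obj, Path x z × Path z y) (t : Σ z : Q₁.Obj, Path s.1 z × Path z y),
        ((splits (((koszulPath s.2.1).cons (D₁.map t.2.1)).comp t.2.2)).map fun r =>
          ((blocks F r.2.1).map fun c => φ (c.cons (F.map r.2.2))).sum).sum =
        ((splits t.2.2).map fun r =>
          ((blocks F (((koszulPath s.2.1).cons (D₁.map t.2.1)).comp r.2.1)).map fun c =>
            φ (c.cons (F.map r.2.2))).sum).sum +
        ((splits s.2.1).map fun r =>
          ((blocks F (koszulPath r.2.1)).map fun c =>
            φ (c.cons (F.map (((koszulPath r.2.2).cons (D₁.map t.2.1)).comp t.2.2)))).sum).sum := by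
      intro s t
      rw [splits_marked (koszulPath s.2.1) (D₁.map t.2.1) t.2.2
        (fun a b => ((blocks F a).map fun c => φ (c.cons (F.map b))).sum), splits_koszulPath,
        List.map_map]
      rfl
    simp only [hm, List.sum_map_add]
    congr 1
    · have h1 : ∀ s : Σ z : Q₁.Obj, Path x z × Path z y, _ := fun s =>
        splits_coassoc s.2.2 (fun a b c =>
          ((blocks F (((koszulPath s.2.1).cons (D₁.map a)).comp b)).map fun e =>
            φ (e.cons (F.map c))).sum)
      simp only [h1]
      have h2 := splits_coassoc p (fun a b c => ((splits b).map fun r =>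
          ((blocks F (((koszulPath a).cons (D₁.map r.2.1)).comp r.2.2)).map fun e =>
            φ (e.cons (F.map c))).sum).sum)
      rw [h2]
      simp only [sum_insertions]
    · have h0 : ∀ s : Σ z : Q₁.Obj, Path x z × Path z y, _ := fun s =>
        AInfinity.sum_comm (splits s.2.2) (splits s.2.1) (fun t r =>
          ((blocks F (koszulPath r.2.1)).map fun c =>
            φ (c.cons (F.map (((koszulPath r.2.2).cons (D₁.map t.2.1)).comp t.2.2)))).sum)
      simp only [h0]
      have h1 := splits_coassoc p (fun a b c => ((splits c).map fun t =>
        ((blocks F (koszulPath a)).map fun e =>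
          φ (e.cons (F.map (((koszulPath b).cons (D₁.map t.2.1)).comp t.2.2)))).sum).sum)
      rw [← h1]
      rw [sum_blocks_splits F p (fun a b => φ ((koszulPath a).cons (D₂.map b)))]
      congr 1
      refine List.map_congr_left fun s _ => ?_
      have h2 := sum_insertions D₁.map s.2.2 (fun q =>
        ((blocks F (koszulPath s.2.1)).map fun e => φ (e.cons (F.map q))).sum)
      rw [← h2, AInfinity.sum_comm, blocks_koszulPath, List.map_map]
      congr 1
      refine List.map_congr_left fun c _ => ?_
      have hl := hφ.last (koszulPath c)
      simp only [Function.comp_def]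
      rw [← isLinearMap_list_sum hl, ← isLinearMap_list_sum hl, hF]
  rw [key]
  cases p with
  | nil =>
    simp only [splits, blocks, insertions, List.map_cons, List.map_nil, List.sum_cons,
      List.sum_nil, add_zero, List.flatMap_cons, List.flatMap_nil, List.append_nil, koszulPath,
      Path.comp_nil]
    rw [sum_blocks_last_nil F _ hφ, zero_add]
  | cons p f =>
    have hR : ((blocks F (p.cons f)).map fun c => ((insertions D₂.map c).map φ).sum).sum =
        ((blocks F (p.cons f)).map fun c => ((insertions D₂.map c).map φ).sum -
          ((splits c).map fun s => φ ((koszulPath s.2.1).cons (D₂.map s.2.2))).sum).sum +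
        ((blocks F (p.cons f)).map fun c => ((splits c).map fun s =>
          φ ((koszulPath s.2.1).cons (D₂.map s.2.2))).sum).sum := by
      rw [← List.sum_map_add]
      simp
    rw [hR]
    congr 1
    rw [sum_blocks_cons]
    simp only [sum_insertions_cons, add_sub_cancel_right]
    simp only [splits, List.map_cons, List.sum_cons, List.map_map, Function.comp_def]
    rw [List.sum_eq_zero, zero_add]
    · congr 1
      refine List.map_congr_left fun s hs => ?_
      have hl := splits_length p s hs
      exact ih s.2.1.length (by rw [← hn]; exact Nat.lt_succ_of_le hl) s.2.1
        (fun e => φ (e.cons (F.map (s.2.2.cons f)))) (hφ.cons _) rfl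
    · intro m hm
      obtain ⟨c, -, rfl⟩ := List.mem_map.1 hm
      exact sum_blocks_last_nil F _ hφ

theorem IsAInfFunctor.comp {Q₁ Q₂ Q₃ : GradedQuiver.{w, u, v} R} {D₁ : AInfStructure Q₁}
    {D₂ : AInfStructure Q₂} {D₃ : AInfStructure Q₃} {F : FormalMorphism Q₁ Q₂}
    {G : FormalMorphism Q₂ Q₃} (hF : IsAInfFunctor D₁ D₂ F) (hG : IsAInfFunctor D₂ D₃ G) :
    IsAInfFunctor D₁ D₃ (F.comp G) := by
  intro x y p
  refine (hF.sum_comm p G.map (G.multilinear _ _)).trans ?_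
  simp only [hG _ _ _]
  exact (sum_blocks_comp F G p D₃.map (D₃.multilinear _ _)).symm

theorem sum_splits_id {Q : GradedQuiver.{w, u, v} R} {x y y' : Q.Obj}
    (p : Path x y) (D : ∀ z : Q.Obj, Path z y → Q.Hom z y') :
    ((splits p).map fun s =>
      (FormalMorphism.id Q).map ((koszulPath s.2.1).cons (D s.1 s.2.2))).sum = D x p := by
  induction p with
  | nil =>
    simp only [splits, List.map_cons, List.map_nil, List.sum_cons, List.sum_nil, add_zero]
    rfl
  | cons p f ih =>
    have := ih (fun z q => D z (q.cons f))
    simp only [splits, List.map_cons, List.map_map, List.sum_cons, Function.comp_def] at this ⊢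
    rw [this]
    exact zero_add _

theorem IsAInfFunctor.id {Q : GradedQuiver.{w, u, v} R} (D : AInfStructure Q) :
    IsAInfFunctor D D (FormalMorphism.id Q) := by
  intro x y p
  rw [sum_blocks_id p D.map (D.multilinear _ _)]
  cases p with
  | nil =>
    simp only [insertions, splits, List.flatMap_cons, List.flatMap_nil, List.append_nil,
      List.map_cons, List.map_nil, List.sum_cons, List.sum_nil, add_zero]
    rfl
  | cons p f =>
    rw [sum_insertions_cons, List.sum_eq_zero, zero_add]
    · exact sum_splits_id (p.cons f) (fun _ q => D.map q)
    · intro m hm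
      obtain ⟨c, hc, rfl⟩ := List.mem_map.1 hm
      simp only [insertions, List.mem_flatMap, List.mem_map] at hc
      obtain ⟨s, -, ⟨z, t, r⟩, -, rfl⟩ := hc
      cases r with
      | nil => rfl
      | cons r g => rfl

/-- The category of A∞-categories (possibly non-unital and curved) and A∞-functors. -/
instance : Category (AInfCat.{w, u, v} R) where
  Hom A B := AInfFunctor A B
  id A := ⟨FormalMorphism.id A.quiver, IsAInfFunctor.id A.str⟩
  comp F G := ⟨F.toFormal.comp G.toFormal, F.isAInf.comp G.isAInf⟩
  id_comp F := by
    obtain ⟨F, hF⟩ := F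
    congr 1
    exact F.id_comp
  comp_id F := by
    obtain ⟨F, hF⟩ := F
    congr 1
    exact F.comp_id
  assoc F G H := by
    congr 1
    exact FormalMorphism.comp_assoc _ _ _

end AInfinityCategories

/-! ### The graded quiver `(K × A'')_{S'}` -/

section FiberQuiver

variable {R : Type w} [CommRing R]

theorem graded_map_eq_zero {M' M : Type*} [AddCommGroup M'] [Module R M'] [AddCommGroup M]
    [Module R M] {S : ℤ → Submodule R M'} {A : ℤ → Submodule R M} (hA : DirectSum.IsInternal A)
    (g : M' →ₗ[R] M) (hg : ∀ d, ∀ x ∈ S d, g x ∈ A d) {i : ℤ} {x : M'} (hx : x ∈ S i)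
    (hx' : x ∈ ⨆ j, ⨆ (_ : j ≠ i), S j) : g x = 0 := by
  have h1 : g x ∈ ⨆ j, ⨆ (_ : j ≠ i), A j := by
    have : (⨆ j, ⨆ (_ : j ≠ i), S j) ≤ (⨆ j, ⨆ (_ : j ≠ i), A j).comap g :=
      iSup₂_le fun j hj y hy =>
        (le_iSup₂ (f := fun (k : ℤ) (_ : k ≠ i) => A k) j hj) (hg j y hy)
    exact this hx'
  exact (Submodule.disjoint_def.1 (hA.submodule_iSupIndep i)) _ (hg i x hx) h1

theorem graded_components_mem_ker {M N : Type*} [AddCommGroup M] [Module R M] [AddCommGroup N]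
    [Module R N] {A : ℤ → Submodule R M} {B : ℤ → Submodule R N} (hA : DirectSum.IsInternal A)
    (hB : DirectSum.IsInternal B) (F : M →ₗ[R] N) (hF : ∀ d, ∀ x ∈ A d, F x ∈ B d) :
    ⨆ d, (A d).comap (LinearMap.ker F).subtype = ⊤ := by
  classical
  let _ := hA.chooseDecomposition
  let _ := hB.chooseDecomposition
  have key : ∀ (m : M) (d : ℤ),
      (DirectSum.decompose B (F m) d : N) = F (DirectSum.decompose A m d) := by
    intro m d
    induction m using DirectSum.Decomposition.inductionOn A with
    | zero => simp
    | @homogeneous i m =>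
      by_cases h : i = d
      · subst h
        rw [DirectSum.decompose_of_mem_same _ (hF i _ m.2),
          DirectSum.decompose_of_mem_same _ m.2]
      · rw [DirectSum.decompose_of_mem_ne _ (hF i _ m.2) h,
          DirectSum.decompose_of_mem_ne _ m.2 h, map_zero]
    | add m m' h h' => simp [h, h']
  rw [eq_top_iff]
  rintro ⟨k, hk⟩ -
  have hk' : ∀ d, (DirectSum.decompose A k d : M) ∈ LinearMap.ker F := fun d => by
    rw [LinearMap.mem_ker, ← key, LinearMap.mem_ker.1 hk]
    simp
  have : (⟨k, hk⟩ : LinearMap.ker F) =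
      ∑ d ∈ (DirectSum.decompose A k).support, ⟨DirectSum.decompose A k d, hk' d⟩ := by
    ext
    simp only [AddSubmonoidClass.coe_finsetSum]
    exact (DirectSum.sum_support_decompose A k).symm
  rw [this]
  exact Submodule.sum_mem _ fun d _ => Submodule.mem_iSup_of_mem d
    (by simp)

variable {Q Q' Q'' : GradedQuiver.{w, u, v} R}

/-- Given formal morphisms `F : Q → Q'` and `G : Q'' → Q'` with `K(x₁, x₂) = Ker F¹(x₁, x₂)`, the
graded quiver whose objects are the pairs `(x, y)` with `F⁰ x = G⁰ y` and whose morphisms from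
`(x₁, y₁)` to `(x₂, y₂)` are `K(x₁, x₂) ⊕ Q''(y₁, y₂)`. -/
def fiberQuiver (F : FormalMorphism Q Q') (G : FormalMorphism Q'' Q') :
    GradedQuiver.{w, u, v} R where
  Obj := {p : Q.Obj × Q''.Obj // F.obj p.1 = G.obj p.2}
  Hom p q := LinearMap.ker (F.lin p.1.1 q.1.1) × Q''.Hom p.1.2 q.1.2
  deg p q d := ((Q.deg p.1.1 q.1.1 d).comap (LinearMap.ker (F.lin p.1.1 q.1.1)).subtype).prod
    (Q''.deg p.1.2 q.1.2 d)
  isInternal p q := by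
    rw [DirectSum.isInternal_submodule_iff_iSupIndep_and_iSup_eq_top]
    refine ⟨fun i => Submodule.disjoint_def.2 fun x hx hx' => ?_, ?_⟩
    · have h1 := graded_map_eq_zero (Q.isInternal p.1.1 q.1.1)
        ((LinearMap.ker (F.lin p.1.1 q.1.1)).subtype ∘ₗ LinearMap.fst R _ _)
        (S := fun d => ((Q.deg p.1.1 q.1.1 d).comap
          (LinearMap.ker (F.lin p.1.1 q.1.1)).subtype).prod (Q''.deg p.1.2 q.1.2 d))
        (fun d x hx => (Submodule.mem_prod.1 hx).1) hx hx'
      have h2 := graded_map_eq_zero (Q''.isInternal p.1.2 q.1.2) (LinearMap.snd R _ _)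
        (S := fun d => ((Q.deg p.1.1 q.1.1 d).comap
          (LinearMap.ker (F.lin p.1.1 q.1.1)).subtype).prod (Q''.deg p.1.2 q.1.2 d))
        (fun d x hx => (Submodule.mem_prod.1 hx).2) hx hx'
      exact Prod.ext (Subtype.ext h1) h2
    · rw [eq_top_iff]
      rintro ⟨k, a⟩ -
      have hk : k ∈ ⨆ d, (Q.deg p.1.1 q.1.1 d).comap
          (LinearMap.ker (F.lin p.1.1 q.1.1)).subtype := by
        rw [graded_components_mem_ker (Q.isInternal p.1.1 q.1.1) (Q'.isInternal _ _) _
          (fun d x hx => F.lin_mem hx)]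
        trivial
      have ha : a ∈ ⨆ d, Q''.deg p.1.2 q.1.2 d := by
        rw [(Q''.isInternal p.1.2 q.1.2).submodule_iSup_eq_top]
        trivial
      have h1 := Submodule.mem_map_of_mem (f := LinearMap.inl R
        (LinearMap.ker (F.lin p.1.1 q.1.1)) (Q''.Hom p.1.2 q.1.2)) hk
      have h2 := Submodule.mem_map_of_mem (f := LinearMap.inr R
        (LinearMap.ker (F.lin p.1.1 q.1.1)) (Q''.Hom p.1.2 q.1.2)) ha
      rw [Submodule.map_iSup] at h1 h2
      have h3 : ((k, a) : LinearMap.ker (F.lin p.1.1 q.1.1) × Q''.Hom p.1.2 q.1.2) =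
          LinearMap.inl R _ _ k + LinearMap.inr R _ _ a := by simp
      rw [h3]
      have h4 := iSup_mono (fun d => show Submodule.map (LinearMap.inl R _ _)
          ((Q.deg p.1.1 q.1.1 d).comap (LinearMap.ker (F.lin p.1.1 q.1.1)).subtype) ≤
          ((Q.deg p.1.1 q.1.1 d).comap (LinearMap.ker (F.lin p.1.1 q.1.1)).subtype).prod
            (Q''.deg p.1.2 q.1.2 d) from by
        rintro _ ⟨k, hk, rfl⟩
        exact ⟨hk, Submodule.zero_mem _⟩)
      have h5 := iSup_mono (fun d => show Submodule.map (LinearMap.inr R _ _)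
          (Q''.deg p.1.2 q.1.2 d) ≤
          ((Q.deg p.1.1 q.1.1 d).comap (LinearMap.ker (F.lin p.1.1 q.1.1)).subtype).prod
            (Q''.deg p.1.2 q.1.2 d) from by
        rintro _ ⟨a, ha, rfl⟩
        exact ⟨Submodule.zero_mem _, ha⟩)
      exact Submodule.add_mem _ (h4 h1) (h5 h2)

/-- The projection `(K × Q'')_{S'} → Q''`, a functor of graded quivers. -/
def fiberSnd (F : FormalMorphism Q Q') (G : FormalMorphism Q'' Q') :
    FormalMorphism (fiberQuiver F G) Q'' :=
  FormalMorphism.strict (Q₁ := fiberQuiver F G) (fun p => p.1.2)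
    (fun p q => LinearMap.snd R (LinearMap.ker (F.lin p.1.1 q.1.1)) (Q''.Hom p.1.2 q.1.2))
    (fun _ _ _ _ h => h.2)

end FiberQuiver

/-! ### Condition (F1), flatness and strict units -/

section Conditions

variable {R : Type w} [CommRing R]

/-- Condition (F1): for all objects `x`, `y`, the linear part `F¹ : A(x, y) → B(F x, F y)` is a
surjection which splits in the category of graded `R`-modules. -/
def AInfFunctor.SatisfiesF1 {A B : AInfCat.{w, u, v} R} (F : A ⟶ B) : Prop :=
  ∀ x y : A.quiver.Obj, ∃ s : B.quiver.Hom (F.toFormal.obj x) (F.toFormal.obj y) →ₗ[R]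
      A.quiver.Hom x y,
    (∀ (d : ℤ), ∀ g ∈ B.quiver.deg (F.toFormal.obj x) (F.toFormal.obj y) d,
      s g ∈ A.quiver.deg x y d) ∧
    F.toFormal.lin x y ∘ₗ s = LinearMap.id

/-- An A∞-category is flat if it has no curvature. -/
def AInfCat.IsFlat (A : AInfCat.{w, u, v} R) : Prop :=
  ∀ x : A.quiver.Obj, A.str.map (Path.nil : Path x x) = 0

/-- `e` is a strict unit at `x`: it has degree `0`, every `Dⁿ` with `n ≠ 2` vanishes if one of its
arguments is `e`, and `D²(f, e) = f`, `D²(e, f) = (-1) ^ (deg f) f`. -/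
def AInfStructure.IsStrictUnit {Q : GradedQuiver.{w, u, v} R} (D : AInfStructure Q) {x : Q.Obj}
    (e : Q.Hom x x) : Prop :=
  e ∈ Q.deg x x 0 ∧
  (∀ (a b : Q.Obj) (p : Path a x) (q : Path x b), p.length + q.length ≠ 1 →
    D.map ((p.cons e).comp q) = 0) ∧
  (∀ (y : Q.Obj) (f : Q.Hom x y), D.map ((Path.nil.cons e).cons f) = f) ∧
  (∀ (y : Q.Obj) (d : ℤ), ∀ f ∈ Q.deg y x d,
    D.map ((Path.nil.cons f).cons e) = (d.negOnePow : ℤ) • f)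

/-- An A∞-category is strictly unital if every object has a strict unit (which is then unique). -/
def AInfCat.IsStrictlyUnital (A : AInfCat.{w, u, v} R) : Prop :=
  ∀ x : A.quiver.Obj, ∃ e : A.quiver.Hom x x, A.str.IsStrictUnit e

/-- An A∞-functor is strictly unital if `F¹` maps strict units to strict units and every `Fⁿ` with
`n ≥ 2` vanishes if one of its arguments is a strict unit. -/
def AInfFunctor.IsStrictlyUnital {A B : AInfCat.{w, u, v} R} (F : A ⟶ B) : Prop :=
  ∀ (x : A.quiver.Obj) (e : A.quiver.Hom x x), A.str.IsStrictUnit e →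
    B.str.IsStrictUnit (F.toFormal.lin x x e) ∧
    ∀ (a b : A.quiver.Obj) (p : Path a x) (q : Path x b), p.length + q.length ≠ 0 →
      F.toFormal.map ((p.cons e).comp q) = 0

/-- A strictly unital A∞-category. -/
structure SUAInfCat (R : Type w) [CommRing R] where
  toAInfCat : AInfCat.{w, u, v} R
  isStrictlyUnital : toAInfCat.IsStrictlyUnital

/-- A partition of a chain with a marked morphism `e`, killed by all `Fⁿ` with `n ≥ 2`. -/
theorem sum_blocks_marked {Q₁ Q₂ : GradedQuiver.{w, u, v} R} (F : FormalMorphism Q₁ Q₂)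
    {x : Q₁.Obj} (e : Q₁.Hom x x)
    (he : ∀ (a b : Q₁.Obj) (p : Path a x) (q : Path x b), p.length + q.length ≠ 0 →
      F.map ((p.cons e).comp q) = 0)
    {M : Type*} [AddCommGroup M] [Module R M] {a b : Q₁.Obj} (p : Path a x) (q : Path x b)
    (φ : Path (F.obj a) (F.obj b) → M) (hφ : IsMultilinear φ) :
    ((blocks F ((p.cons e).comp q)).map φ).sum = ((blocks F p).map fun c =>
      ((blocks F q).map fun d => φ ((c.cons (F.lin x x e)).comp d)).sum).sum := by
  induction hn : q.length using Nat.strong_induction_on generalizing b with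
  | _ n ih =>
  have h0 : ∀ {z : Q₁.Obj} (l : List (Path (F.obj a) (F.obj z))) (r : Path z x) (q : Path x b),
      r.length + q.length ≠ 0 →
      (l.map fun c => φ (c.cons (F.map ((r.cons e).comp q)))).sum = 0 := by
    intro z l r q h
    refine List.sum_eq_zero fun m hm => ?_
    obtain ⟨c, -, rfl⟩ := List.mem_map.1 hm
    rw [he _ _ r q h]
    exact (hφ.last c).map_zero
  cases q with
  | nil =>
    rw [Path.comp_nil, sum_blocks_cons]
    simp only [Path.comp_nil, blocks, List.map_cons, List.map_nil, List.sum_cons,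
      List.sum_nil, add_zero]
    cases p with
    | nil => simp [splits]; rfl
    | cons p f =>
      simp only [splits, List.map_cons, List.sum_cons, List.map_map, Function.comp_def]
      rw [List.sum_eq_zero (l := (splits p).map _), add_zero]
      · rfl
      · intro m hm
        obtain ⟨s, -, rfl⟩ := List.mem_map.1 hm
        exact h0 _ (s.2.2.cons f) Path.nil (by simp)
  | cons q g =>
    rw [Path.comp_cons, sum_blocks_cons, splits_marked p e q (fun c d =>
      ((blocks F c).map fun c => φ (c.cons (F.map (d.cons g)))).sum)]
    rw [List.sum_eq_zero (l := (splits p).map _), add_zero]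
    · simp only [sum_blocks_cons F q g]
      rw [sum_comm]
      congr 1
      refine List.map_congr_left fun s hs => ?_
      have hl := splits_length q s hs
      exact ih s.2.1.length (by rw [← hn]; exact Nat.lt_succ_of_le hl) s.2.1
        (fun c => φ (c.cons (F.map (s.2.2.cons g)))) (hφ.cons _) rfl
    · intro m hm
      obtain ⟨s, -, rfl⟩ := List.mem_map.1 hm
      exact h0 _ s.2.2 (q.cons g) (by simp)

theorem AInfFunctor.IsStrictlyUnital.comp {A B C : AInfCat.{w, u, v} R} {F : A ⟶ B} {G : B ⟶ C}
    (hF : AInfFunctor.IsStrictlyUnital F) (hG : AInfFunctor.IsStrictlyUnital G) :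
    AInfFunctor.IsStrictlyUnital (F ≫ G) := by
  intro x e he
  obtain ⟨h1, h2⟩ := hF x e he
  obtain ⟨h3, h4⟩ := hG _ _ h1
  refine ⟨?_, fun a b p q h => ?_⟩
  · have : (F ≫ G).toFormal.lin x x e = G.toFormal.lin _ _ (F.toFormal.lin x x e) := by
      change ((blocks F.toFormal (Path.nil.cons e)).map G.toFormal.map).sum = _
      simp only [blocks, blocksAux, List.map_cons, List.map_nil, List.sum_cons, List.sum_nil,
        add_zero]
      rfl
    rw [this]
    exact h3
  · refine (sum_blocks_marked F.toFormal e h2 p q _ (G.toFormal.multilinear _ _)).trans ?_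
    refine List.sum_eq_zero fun m hm => ?_
    obtain ⟨c, hc, rfl⟩ := List.mem_map.1 hm
    refine List.sum_eq_zero fun m hm => ?_
    obtain ⟨d, hd, rfl⟩ := List.mem_map.1 hm
    refine h4 _ _ c d fun h0 => h ?_
    have hp : p.length = 0 := by
      cases p with
      | nil => rfl
      | cons p f =>
        obtain ⟨_, c', g, rfl⟩ := blocksAux_pos F.toFormal _ _ c hc
        simp at h0
    have hq : q.length = 0 := by
      cases q with
      | nil => rfl
      | cons q f =>
        obtain ⟨_, c', g, rfl⟩ := blocksAux_pos F.toFormal _ _ d hd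
        simp at h0
    omega

theorem AInfFunctor.IsStrictlyUnital.id (A : AInfCat.{w, u, v} R) :
    AInfFunctor.IsStrictlyUnital (𝟙 A) := by
  refine fun x e he => ⟨he, fun a b p q h => ?_⟩
  cases q with
  | nil =>
    cases p with
    | nil => exact absurd rfl h
    | cons p f => rfl
  | cons q g =>
    cases q with
    | nil => rfl
    | cons q g => rfl

/-- The category of strictly unital A∞-categories and strictly unital A∞-functors. -/
instance : Category (SUAInfCat.{w, u, v} R) where
  Hom A B := {F : A.toAInfCat ⟶ B.toAInfCat // AInfFunctor.IsStrictlyUnital F}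
  id A := ⟨𝟙 A.toAInfCat, AInfFunctor.IsStrictlyUnital.id _⟩
  comp F G := ⟨F.1 ≫ G.1, F.2.comp G.2⟩

/-- A strictly unital A∞-functor as a morphism of strictly unital A∞-categories. -/
def SUAInfCat.ofHom {A B : AInfCat.{w, u, v} R} (hA : A.IsStrictlyUnital)
    (hB : B.IsStrictlyUnital) (F : A ⟶ B) (hF : AInfFunctor.IsStrictlyUnital F) :
    (⟨A, hA⟩ : SUAInfCat.{w, u, v} R) ⟶ ⟨B, hB⟩ :=
  ⟨F, hF⟩

end Conditions

end AInfinity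

open AInfinity

/-!
Write `F · X` for the composition of formal morphisms, and let `s` be a section of `F¹` with
associated projection `κ = 1 - s F¹` onto the kernel of `F¹`. The argument rests on one observation:
a formal morphism `X` with values in the source of `F` is the same thing as the pair `(κ X, F · X)`.
Indeed, on a chain of length `n` the value of `F · X` is `F¹ Xⁿ` plus terms in the components of `X`
of lower arity (`sum_blocks_sub_congr`), so that `Xⁿ` can be solved for recursively. This gives
uniqueness (`Components.ext_of_kerProj`) and existence (`Splitting.exists_lift`).

Applied to the fiber quiver `P` with the projection `α` to `A''`, this produces `β : P → A` with
`F · β = G · α` such that `κ β` is the linear projection to the kernel of `F¹`. On the level of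
formal morphisms `P` is then a pullback: the morphism induced by `J` and `H` is `(κ J, H)`.

The A∞-structure `D` of `P` has to make `α` and `β` functors. As `κ β` and `α` are linear, this
forces `D p = (κ ∑ D_A(β(block r), …, β(block 1)), D''(α p))` (`fiberMap`), the sum over all
partitions of the chain `p` into blocks. With this definition `α` satisfies the functor equation. If
`β` satisfies it on all chains shorter than `p`, its defect on `p` is killed by `κ` by construction,
and it is killed by `F¹` because the defect of `F · β` on `p` is `F¹` of the defect of `β`
(`sum_insertions_blocks`), while `F · β = G · α` is compatible with the A∞-structures. Hence `β` is
an A∞-functor (`IsFiberFst.sum_insertions`), and the A∞-relations for `D` follow by applying `α` and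
`β` to them.

If `u` and `u''` are strict units, then `(κ u, u'')` is a strict unit of `P`: again by the pair
`(κ β, F · β)`, the map `β` sends it to `u` and its higher components vanish on it. Finally, the
linear part of `α` is split by `a ↦ (0, a)`, and any other pullback is isomorphic to `P` over `A''`,
where the linear part of an isomorphism is split by that of its inverse.
-/

namespace AInfinity

open Quiver (Path)

/-! ### Sums over partitions of chains -/

section Partitions

variable {R : Type w} [CommRing R] {Q Q₁ Q₂ Q₃ : GradedQuiver.{w, u, v} R}

/-- The components of a formal morphism whose map on objects is prescribed to be `o`. Fixing
`o` makes the components of two formal morphisms with the same map on objects comparable without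
transport along an equality of maps on objects. -/
structure Components (Q₁ Q₂ : GradedQuiver.{w, u, v} R) (o : Q₁.Obj → Q₂.Obj) where
  map : ∀ {x y : Q₁.Obj}, Path x y → Q₂.Hom (o x) (o y)
  map_nil : ∀ x : Q₁.Obj, map (Path.nil : Path x x) = 0
  multilinear : ∀ x y : Q₁.Obj, IsMultilinear (map : Path x y → Q₂.Hom (o x) (o y))
  map_mem : ∀ {x y : Q₁.Obj} (p : Path x y) (d : ℤ), HasDeg p d →
    map p ∈ Q₂.deg (o x) (o y) (d + 1)

/-- The formal morphism with the given map on objects and the given components. -/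
@[reducible] def Components.toFormal {o : Q₁.Obj → Q₂.Obj} (X : Components Q₁ Q₂ o) :
    FormalMorphism Q₁ Q₂ where
  obj := o
  map := X.map
  map_nil := X.map_nil
  multilinear := X.multilinear
  map_mem := X.map_mem

/-- The components of a formal morphism, with the map on objects replaced by an equal one. -/
def Components.ofFormal (F : FormalMorphism Q₁ Q₂) (o : Q₁.Obj → Q₂.Obj) (h : F.obj = o) :
    Components Q₁ Q₂ o :=
  h ▸ { map := F.map, map_nil := F.map_nil, multilinear := F.multilinear, map_mem := F.map_mem }

theorem Components.toFormal_ofFormal (F : FormalMorphism Q₁ Q₂) (o : Q₁.Obj → Q₂.Obj)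
    (h : F.obj = o) : (Components.ofFormal F o h).toFormal = F := by
  subst h
  rfl

theorem blocksAux_congr {o : Q₁.Obj → Q₂.Obj} {X Y : Components Q₁ Q₂ o} {n : ℕ}
    (h : ∀ {x y : Q₁.Obj} (p : Path x y), p.length ≤ n → X.map p = Y.map p) {x y z : Q₁.Obj}
    (p : Path x y) (q : Path y z) (hn : p.length + q.length ≤ n) :
    blocksAux X.toFormal p q = blocksAux Y.toFormal p q := by
  induction p generalizing z with
  | nil =>
    have := h q (by omega)
    simp only [blocksAux, this]
  | cons p f ih =>
    rw [Path.length_cons] at hn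
    have h1 := ih ((Path.nil.cons f).comp q)
      (by simp only [Path.length_comp, Path.length_cons, Path.length_nil]; omega)
    have h2 := ih (Path.nil.cons f) (by simp only [Path.length_cons, Path.length_nil]; omega)
    have h3 := h q (by omega)
    simp only [blocksAux, h1, h2, h3]

/-- The sum over the partitions of a chain depends only on the components on chains which are not
longer. -/
theorem blocks_congr {o : Q₁.Obj → Q₂.Obj} {X Y : Components Q₁ Q₂ o} {x y : Q₁.Obj}
    (p : Path x y)
    (h : ∀ {a b : Q₁.Obj} (q : Path a b), q.length ≤ p.length → X.map q = Y.map q) :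
    blocks X.toFormal p = blocks Y.toFormal p := by
  cases p with
  | nil => rfl
  | cons p f => exact blocksAux_congr h p (Path.nil.cons f) (by simp)

theorem sum_blocksAux_sub_congr {o : Q₁.Obj → Q₂.Obj} {X Y : Components Q₁ Q₂ o} {n : ℕ}
    (h : ∀ {x y : Q₁.Obj} (p : Path x y), p.length < n → X.map p = Y.map p)
    {M : Type*} [AddCommGroup M] {x y z : Q₁.Obj} (p : Path x y) (q : Path y z)
    (hq : 0 < q.length) (hn : p.length + q.length ≤ n) (φ : Path (o x) (o z) → M) :
    ((blocksAux X.toFormal p q).map φ).sum - φ (Path.nil.cons (X.map (p.comp q))) =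
      ((blocksAux Y.toFormal p q).map φ).sum - φ (Path.nil.cons (Y.map (p.comp q))) := by
  induction p generalizing z with
  | nil => simp [blocksAux]
  | cons p f ih =>
    rw [Path.length_cons] at hn
    have h1 := ih ((Path.nil.cons f).comp q) (by simp [Path.length_comp])
      (by simp only [Path.length_comp, Path.length_cons, Path.length_nil]; omega) φ
    have h2 := blocksAux_congr (n := n - 1) (fun r hr => h r (by omega)) p (Path.nil.cons f)
      (by simp only [Path.length_cons, Path.length_nil]; omega)
    have h3 := h q (by omega)
    rw [← Path.comp_assoc, Path.comp_cons, Path.comp_nil] at h1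
    simp only [blocksAux, List.map_append, List.sum_append, h2, h3]
    rw [add_sub_right_comm, h1, add_sub_right_comm]

/-- The terms with at least two blocks depend only on the components on strictly shorter chains. -/
theorem sum_blocks_sub_congr {o : Q₁.Obj → Q₂.Obj} {X Y : Components Q₁ Q₂ o} {x y : Q₁.Obj}
    (p : Path x y)
    (h : ∀ {a b : Q₁.Obj} (q : Path a b), q.length < p.length → X.map q = Y.map q)
    {M : Type*} [AddCommGroup M] (φ : Path (o x) (o y) → M) :
    ((blocks X.toFormal p).map φ).sum - φ (Path.nil.cons (X.map p)) =
      ((blocks Y.toFormal p).map φ).sum - φ (Path.nil.cons (Y.map p)) := by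
  cases p with
  | nil => simp only [blocks, X.map_nil, Y.map_nil]
  | cons p f => exact sum_blocksAux_sub_congr h p (Path.nil.cons f) (by simp) (by simp) φ

theorem length_pos_of_mem_blocks (F : FormalMorphism Q₁ Q₂) {x y : Q₁.Obj} {p : Path x y}
    (hp : p.length ≠ 0) {c} (hc : c ∈ blocks F p) : c.length ≠ 0 := by
  cases p with
  | nil => simp at hp
  | cons p f =>
    obtain ⟨_, c', g, rfl⟩ := blocksAux_pos F _ _ c hc
    simp

/-- If `φ` vanishes on chains of length at least `2`, only the partition into one block counts. -/
theorem sum_blocks_of_length (F : FormalMorphism Q₁ Q₂) {M : Type*} [AddCommMonoid M]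
    {x y : Q₁.Obj} (p : Path x y) (hp : p.length ≠ 0) (φ : Path (F.obj x) (F.obj y) → M)
    (hφ : ∀ c, 1 < c.length → φ c = 0) :
    ((blocks F p).map φ).sum = φ (Path.nil.cons (F.map p)) := by
  have key : ∀ {y z : Q₁.Obj} (p : Path x y) (q : Path y z) (φ : Path (F.obj x) (F.obj z) → M),
      (∀ c, 1 < c.length → φ c = 0) →
      ((blocksAux F p q).map φ).sum = φ (Path.nil.cons (F.map (p.comp q))) := by
    intro y z p
    induction p generalizing z with
    | nil => intro q φ _; simp [blocksAux]
    | cons p f ih =>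
      intro q φ hφ
      simp only [blocksAux, List.map_append, List.sum_append, List.map_map]
      rw [ih _ φ hφ, List.sum_eq_zero, add_zero, ← Path.comp_assoc]
      · rfl
      · intro m hm
        obtain ⟨c, hc, rfl⟩ := List.mem_map.1 hm
        obtain ⟨w, c', g, rfl⟩ := blocksAux_pos F _ _ c hc
        exact hφ _ (by simp)
  cases p with
  | nil => simp at hp
  | cons p f => exact key p (Path.nil.cons f) φ hφ

theorem sum_splits_sub_congr {M : Type*} [AddCommGroup M] {x y : Q.Obj} (p : Path x y)
    (θ θ' : ∀ {a : Q.Obj}, Path x a → Path a y → M)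
    (hθ : ∀ {a : Q.Obj} (b : Path x a) (c : Path a y), b.length + c.length = p.length →
      b.length ≠ 0 → θ b c = θ' b c) :
    ((splits p).map fun s => θ s.2.1 s.2.2).sum - θ Path.nil p =
      ((splits p).map fun s => θ' s.2.1 s.2.2).sum - θ' Path.nil p := by
  induction p with
  | nil => simp [splits]
  | cons p f ih =>
    simp only [splits, List.map_cons, List.sum_cons, List.map_map, Function.comp_def]
    rw [hθ _ _ (by simp) (by simp), add_sub_assoc, add_sub_assoc]
    congr 1
    exact ih (fun b c => θ b (c.cons f)) (fun b c => θ' b (c.cons f))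
      (fun b c h => hθ b _ (by simp only [Path.length_cons]; omega))

theorem length_koszulPath {x y : Q.Obj} (p : Path x y) : (koszulPath p).length = p.length := by
  induction p with
  | nil => rfl
  | cons p f ih => simp [koszulPath, ih]

/-- If `φ` vanishes on chains of length at least `2`, only the insertion of `D` applied to the whole
chain counts. -/
theorem sum_insertions_of_length (D : ∀ {x y : Q.Obj}, Path x y → Q.Hom x y) {M : Type*}
    [AddCommGroup M] {x y : Q.Obj} (p : Path x y) (φ : Path x y → M)
    (hφ : ∀ c, 1 < c.length → φ c = 0) :
    ((insertions D p).map φ).sum = φ (Path.nil.cons (D p)) := by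
  have hl : ∀ {x y : Q.Obj} (p : Path x y), ∀ c ∈ insertions D p, c.length ≠ 0 := by
    intro x y p c hc
    simp only [insertions, List.mem_flatMap, List.mem_map] at hc
    obtain ⟨s, -, t, -, rfl⟩ := hc
    simp [Path.length_comp]
  cases p with
  | nil => simp [insertions, splits, koszulPath]
  | cons p f =>
    rw [sum_insertions_cons, List.sum_eq_zero, zero_add]
    · have := sum_splits_sub_congr (p.cons f) (fun a b => φ ((koszulPath a).cons (D b)))
        (fun _ _ => 0) fun b c _ hb => hφ _ (by rw [Path.length_cons, length_koszulPath]; omega)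
      simpa [koszulPath, sub_eq_zero] using this
    · intro m hm
      obtain ⟨c, hc, rfl⟩ := List.mem_map.1 hm
      have := hl p c hc
      exact hφ _ (by rw [Path.length_cons]; omega)

/-- A formal morphism intertwines the coderivations defined by `D₁` and `D₂` on a chain, up to the
defect of the functor equation on that chain, as soon as the functor equation holds on shorter
chains. Neither `D₁` nor `D₂` has to square to zero. -/
theorem sum_insertions_blocks (D₁ : ∀ {x y : Q₁.Obj}, Path x y → Q₁.Hom x y)
    (D₂ : ∀ {x y : Q₂.Obj}, Path x y → Q₂.Hom x y) (F : FormalMorphism Q₁ Q₂) {M : Type*}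
    [AddCommGroup M] [Module R M] {x y : Q₁.Obj} (p : Path x y)
    (hF : ∀ {a b : Q₁.Obj} (q : Path a b), q.length < p.length →
      ((insertions D₁ q).map F.map).sum = ((blocks F q).map D₂).sum)
    (φ : Path (F.obj x) (F.obj y) → M) (hφ : IsMultilinear φ) :
    ((insertions D₁ p).map fun q => ((blocks F q).map φ).sum).sum -
        φ (Path.nil.cons ((insertions D₁ p).map F.map).sum) =
      ((blocks F p).map fun c => ((insertions D₂ c).map φ).sum).sum -
        φ (Path.nil.cons ((blocks F p).map D₂).sum) := by
  induction hn : p.length using Nat.strong_induction_on generalizing y with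
  | _ n ih =>
  have key : ((insertions D₁ p).map fun q => ((blocks F q).map φ).sum).sum =
      ((splits p).map fun s => ((insertions D₁ s.2.1).map fun q =>
        ((blocks F q).map fun c => φ (c.cons (F.map s.2.2))).sum).sum).sum +
      ((splits p).map fun s => ((blocks F s.2.1).map fun c =>
        φ ((koszulPath c).cons ((insertions D₁ s.2.2).map F.map).sum)).sum).sum := by
    rw [AInfStructure.insertions_ne_nil D₁ F p hφ, sum_insertions]
    have hm : ∀ (s : Σ z : Q₁.Obj, Path x z × Path z y) (t : Σ z : Q₁.Obj, Path s.1 z × Path z y),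
        ((splits (((koszulPath s.2.1).cons (D₁ t.2.1)).comp t.2.2)).map fun r =>
          ((blocks F r.2.1).map fun c => φ (c.cons (F.map r.2.2))).sum).sum =
        ((splits t.2.2).map fun r =>
          ((blocks F (((koszulPath s.2.1).cons (D₁ t.2.1)).comp r.2.1)).map fun c =>
            φ (c.cons (F.map r.2.2))).sum).sum +
        ((splits s.2.1).map fun r =>
          ((blocks F (koszulPath r.2.1)).map fun c =>
            φ (c.cons (F.map (((koszulPath r.2.2).cons (D₁ t.2.1)).comp t.2.2)))).sum).sum := by
      intro s t
      rw [splits_marked (koszulPath s.2.1) (D₁ t.2.1) t.2.2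
        (fun a b => ((blocks F a).map fun c => φ (c.cons (F.map b))).sum), splits_koszulPath,
        List.map_map]
      rfl
    simp only [hm, List.sum_map_add]
    congr 1
    · have h1 : ∀ s : Σ z : Q₁.Obj, Path x z × Path z y, _ := fun s =>
        splits_coassoc s.2.2 (fun a b c =>
          ((blocks F (((koszulPath s.2.1).cons (D₁ a)).comp b)).map fun e =>
            φ (e.cons (F.map c))).sum)
      simp only [h1]
      have h2 := splits_coassoc p (fun a b c => ((splits b).map fun r =>
          ((blocks F (((koszulPath a).cons (D₁ r.2.1)).comp r.2.2)).map fun e =>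
            φ (e.cons (F.map c))).sum).sum)
      rw [h2]
      simp only [sum_insertions]
    · have h0 : ∀ s : Σ z : Q₁.Obj, Path x z × Path z y, _ := fun s =>
        AInfinity.sum_comm (splits s.2.2) (splits s.2.1) (fun t r =>
          ((blocks F (koszulPath r.2.1)).map fun c =>
            φ (c.cons (F.map (((koszulPath r.2.2).cons (D₁ t.2.1)).comp t.2.2)))).sum)
      simp only [h0]
      have h1 := splits_coassoc p (fun a b c => ((splits c).map fun t =>
        ((blocks F (koszulPath a)).map fun e =>
          φ (e.cons (F.map (((koszulPath b).cons (D₁ t.2.1)).comp t.2.2)))).sum).sum)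
      rw [← h1]
      congr 1
      refine List.map_congr_left fun s _ => ?_
      have h2 := sum_insertions D₁ s.2.2 (fun q =>
        ((blocks F (koszulPath s.2.1)).map fun e => φ (e.cons (F.map q))).sum)
      rw [← h2, AInfinity.sum_comm, blocks_koszulPath, List.map_map]
      congr 1
      refine List.map_congr_left fun c _ => ?_
      exact (isLinearMap_list_sum (hφ.last (koszulPath c)) _ _).symm
  have hdef := sum_splits_sub_congr p
    (fun a b => ((blocks F a).map fun c =>
      φ ((koszulPath c).cons ((insertions D₁ b).map F.map).sum)).sum)
    (fun a b => ((blocks F a).map fun c =>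
      φ ((koszulPath c).cons ((blocks F b).map D₂).sum)).sum)
    (fun a b h ha => by simp only [hF b (by omega)])
  have hV : ((splits p).map fun s => ((blocks F s.2.1).map fun c =>
      φ ((koszulPath c).cons ((blocks F s.2.2).map D₂).sum)).sum).sum =
      ((blocks F p).map fun c => ((splits c).map fun s =>
        φ ((koszulPath s.2.1).cons (D₂ s.2.2))).sum).sum := by
    rw [sum_blocks_splits F p (fun a b => φ ((koszulPath a).cons (D₂ b)))]
    congr 1
    refine List.map_congr_left fun s _ => ?_
    congr 1
    refine List.map_congr_left fun c _ => ?_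
    exact isLinearMap_list_sum (hφ.last (koszulPath c)) _ _
  have hb : blocks F (Path.nil : Path x x) = [Path.nil] := rfl
  have hk : koszulPath (Path.nil : Path (F.obj x) (F.obj x)) = Path.nil := rfl
  simp only [hb, hk, List.map_cons, List.map_nil, List.sum_cons, List.sum_nil, add_zero] at hdef
  rw [key, add_sub_assoc, hdef, hV, ← add_sub_assoc]
  congr 1
  cases p with
  | nil =>
    simp only [splits, blocks, insertions, List.map_cons, List.map_nil, List.sum_cons,
      List.sum_nil, add_zero, List.flatMap_cons, List.flatMap_nil, List.append_nil, koszulPath,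
      Path.comp_nil]
    rw [sum_blocks_last_nil F _ hφ, zero_add]
  | cons p f =>
    have hR : ((blocks F (p.cons f)).map fun c => ((insertions D₂ c).map φ).sum).sum =
        ((blocks F (p.cons f)).map fun c => ((insertions D₂ c).map φ).sum -
          ((splits c).map fun s => φ ((koszulPath s.2.1).cons (D₂ s.2.2))).sum).sum +
        ((blocks F (p.cons f)).map fun c => ((splits c).map fun s =>
          φ ((koszulPath s.2.1).cons (D₂ s.2.2))).sum).sum := by
      rw [← List.sum_map_add]
      simp
    rw [hR]
    congr 1
    rw [sum_blocks_cons]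
    simp only [sum_insertions_cons, add_sub_cancel_right]
    simp only [splits, List.map_cons, List.sum_cons, List.map_map, Function.comp_def]
    rw [List.sum_eq_zero, zero_add]
    · congr 1
      refine List.map_congr_left fun s hs => ?_
      have hl : s.2.1.length < (p.cons f).length := Nat.lt_succ_of_le (splits_length p s hs)
      have := ih s.2.1.length (hn ▸ hl) s.2.1 (fun q hq => hF q (hq.trans hl))
        (fun e => φ (e.cons (F.map (s.2.2.cons f)))) (hφ.cons _) rfl
      -- the functor equation on the shorter chain cancels the two defects
      rwa [hF s.2.1 hl, sub_left_inj] at this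
    · intro m hm
      obtain ⟨c, -, rfl⟩ := List.mem_map.1 hm
      exact sum_blocks_last_nil F _ hφ

/-- A formal morphism satisfying the functor equation intertwines the coderivations. -/
theorem sum_insertions_blocks_of_eq {D₁ : ∀ {x y : Q₁.Obj}, Path x y → Q₁.Hom x y}
    {D₂ : ∀ {x y : Q₂.Obj}, Path x y → Q₂.Hom x y} {F : FormalMorphism Q₁ Q₂}
    (hF : ∀ {a b : Q₁.Obj} (q : Path a b),
      ((insertions D₁ q).map F.map).sum = ((blocks F q).map D₂).sum) {M : Type*}
    [AddCommGroup M] [Module R M] {x y : Q₁.Obj} (p : Path x y)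
    (φ : Path (F.obj x) (F.obj y) → M) (hφ : IsMultilinear φ) :
    ((insertions D₁ p).map fun q => ((blocks F q).map φ).sum).sum =
      ((blocks F p).map fun c => ((insertions D₂ c).map φ).sum).sum := by
  have := sum_insertions_blocks D₁ D₂ F p (fun q _ => hF q) φ hφ
  rwa [hF p, sub_left_inj] at this

end Partitions

/-! ### Lifting formal morphisms along a split surjection -/

section Lifting

variable {R : Type w} [CommRing R] {Q Q₁ Q₂ Q₃ : GradedQuiver.{w, u, v} R}

/-- A section of the linear part `F¹` of a formal morphism, in the category of graded
`R`-modules. -/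
structure Splitting (F : FormalMorphism Q₂ Q₃) where
  sec : ∀ x y : Q₂.Obj, Q₃.Hom (F.obj x) (F.obj y) →ₗ[R] Q₂.Hom x y
  sec_mem : ∀ (x y : Q₂.Obj) (d : ℤ), ∀ g ∈ Q₃.deg (F.obj x) (F.obj y) d,
    sec x y g ∈ Q₂.deg x y d
  lin_sec : ∀ (x y : Q₂.Obj) (g : Q₃.Hom (F.obj x) (F.obj y)), F.lin x y (sec x y g) = g

variable {F : FormalMorphism Q₂ Q₃}

/-- The projection `1 - s F¹` onto the kernel of `F¹` defined by a section `s`. -/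
def Splitting.kerProj (σ : Splitting F) (x y : Q₂.Obj) :
    Q₂.Hom x y →ₗ[R] LinearMap.ker (F.lin x y) :=
  LinearMap.codRestrict _ (LinearMap.id - σ.sec x y ∘ₗ F.lin x y) fun a => by
    simp [σ.lin_sec]

theorem Splitting.coe_kerProj (σ : Splitting F) {x y : Q₂.Obj} (a : Q₂.Hom x y) :
    (σ.kerProj x y a : Q₂.Hom x y) = a - σ.sec x y (F.lin x y a) := rfl

theorem Splitting.kerProj_mem (σ : Splitting F) {x y : Q₂.Obj} {d : ℤ} {a : Q₂.Hom x y}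
    (ha : a ∈ Q₂.deg x y d) : (σ.kerProj x y a : Q₂.Hom x y) ∈ Q₂.deg x y d :=
  Submodule.sub_mem _ ha (σ.sec_mem _ _ _ _ (F.lin_mem ha))

theorem Splitting.kerProj_sec (σ : Splitting F) {x y : Q₂.Obj}
    (g : Q₃.Hom (F.obj x) (F.obj y)) : σ.kerProj x y (σ.sec x y g) = 0 :=
  Subtype.ext (by simp [σ.coe_kerProj, σ.lin_sec])

theorem Splitting.kerProj_coe (σ : Splitting F) {x y : Q₂.Obj} (k : LinearMap.ker (F.lin x y)) :
    σ.kerProj x y k = k :=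
  Subtype.ext (by rw [σ.coe_kerProj, LinearMap.mem_ker.1 k.2]; simp)

theorem Splitting.ext_hom (σ : Splitting F) {x y : Q₂.Obj} {a b : Q₂.Hom x y}
    (h₁ : σ.kerProj x y a = σ.kerProj x y b) (h₂ : F.lin x y a = F.lin x y b) : a = b := by
  have := congrArg Subtype.val h₁
  rwa [σ.coe_kerProj, σ.coe_kerProj, h₂, sub_left_inj] at this

variable {o : Q₁.Obj → Q₂.Obj}

/-- The difference between `F · X` and `F¹` applied to the component of `X` on a chain only involves
the components of `X` on strictly shorter chains. -/
theorem lin_sub_congr {X Y : Components Q₁ Q₂ o} {x y : Q₁.Obj} (p : Path x y)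
    (h : ∀ {a b : Q₁.Obj} (q : Path a b), q.length < p.length → X.map q = Y.map q) :
    (X.toFormal.comp F).map p - F.lin _ _ (X.map p) =
      (Y.toFormal.comp F).map p - F.lin _ _ (Y.map p) :=
  sum_blocks_sub_congr p h F.map

/-- A formal morphism to the source of `F` is determined by its composition with `F` and by its
projection to the kernel of `F¹`. -/
theorem Components.ext_of_kerProj (σ : Splitting F) {X Y : Components Q₁ Q₂ o}
    (h₁ : ∀ {x y : Q₁.Obj} (p : Path x y), σ.kerProj _ _ (X.map p) = σ.kerProj _ _ (Y.map p))
    (h₂ : ∀ {x y : Q₁.Obj} (p : Path x y),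
      (X.toFormal.comp F).map p = (Y.toFormal.comp F).map p)
    {x y : Q₁.Obj} (p : Path x y) : X.map p = Y.map p := by
  induction hn : p.length using Nat.strong_induction_on generalizing x y with
  | _ n ih =>
  refine σ.ext_hom (h₁ p) ?_
  have := lin_sub_congr (F := F) (X := X) (Y := Y) p fun q hq => ih _ (hn ▸ hq) q rfl
  rwa [h₂ p, sub_right_inj] at this

/-- One step `X ↦ X + s (N - F · X)` of the Newton iteration for the equation `F · X = N`. -/
def Splitting.correct (σ : Splitting F) (N : Components Q₁ Q₃ (fun z => F.obj (o z)))
    (X : Components Q₁ Q₂ o) : Components Q₁ Q₂ o where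
  map p := X.map p + σ.sec _ _ (N.map p - (X.toFormal.comp F).map p)
  map_nil x := by
    have := (X.toFormal.comp F).map_nil x
    rw [X.map_nil, N.map_nil, this]
    simp
  multilinear x y a b p q := by
    have h₁ := X.multilinear x y a b p q
    have h₂ := N.multilinear x y a b p q
    have h₃ := (X.toFormal.comp F).multilinear x y a b p q
    exact (IsLinearMap.mk' _ h₁ + σ.sec (o x) (o y) ∘ₗ
      (IsLinearMap.mk' _ h₂ - IsLinearMap.mk' _ h₃)).isLinear
  map_mem p d hp := Submodule.add_mem _ (X.map_mem p d hp) (σ.sec_mem _ _ _ _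
    (Submodule.sub_mem _ (N.map_mem p d hp) ((X.toFormal.comp F).map_mem p d hp)))

theorem Splitting.iterate_correct (σ : Splitting F)
    (N : Components Q₁ Q₃ (fun z => F.obj (o z))) (X : Components Q₁ Q₂ o) (n : ℕ) {x y : Q₁.Obj}
    (p : Path x y) (hp : p.length ≤ n) :
    ((((σ.correct N)^[n] X).toFormal).comp F).map p = N.map p := by
  induction n generalizing x y with
  | zero =>
    cases p with
    | nil => exact (FormalMorphism.map_nil _ _).trans (N.map_nil _).symm
    | cons p f => simp at hp
  | succ n ih =>
    rw [Function.iterate_succ_apply']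
    set Y := (σ.correct N)^[n] X
    have hs : ∀ {a b : Q₁.Obj} (q : Path a b), (σ.correct N Y).map q =
      Y.map q + σ.sec _ _ (N.map q - (Y.toFormal.comp F).map q) := fun q => rfl
    have := lin_sub_congr (F := F) (X := σ.correct N Y) (Y := Y) p fun q hq => by
      rw [hs, ih q (by omega), sub_self, map_zero, add_zero]
    rw [sub_eq_iff_eq_add] at this
    rw [this, hs, map_add, σ.lin_sec]
    abel

theorem Splitting.iterate_correct_stable (σ : Splitting F)
    (N : Components Q₁ Q₃ (fun z => F.obj (o z))) (X : Components Q₁ Q₂ o) {m n : ℕ} {x y : Q₁.Obj}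
    (p : Path x y) (hp : p.length ≤ m) (h : m ≤ n) :
    ((σ.correct N)^[n] X).map p = ((σ.correct N)^[m] X).map p := by
  induction n, h using Nat.le_induction with
  | base => rfl
  | succ n h ih =>
    rw [Function.iterate_succ_apply', ← ih]
    change _ + σ.sec _ _ (_ - _) = _
    rw [σ.iterate_correct N X n p (hp.trans h), sub_self, map_zero, add_zero]

theorem Splitting.kerProj_iterate_correct (σ : Splitting F)
    (N : Components Q₁ Q₃ (fun z => F.obj (o z))) (X : Components Q₁ Q₂ o) (n : ℕ) {x y : Q₁.Obj}
    (p : Path x y) :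
    σ.kerProj _ _ (((σ.correct N)^[n] X).map p) = σ.kerProj _ _ (X.map p) := by
  induction n with
  | zero => rfl
  | succ n ih =>
    rw [Function.iterate_succ_apply', ← ih]
    change σ.kerProj _ _ (_ + σ.sec _ _ _) = _
    rw [map_add, σ.kerProj_sec, add_zero]

/-- A formal morphism to the source of `F` with given composition with `F` and given projection to
the kernel of `F¹` exists. On chains of length `n` the Newton iteration is stationary after `n`
steps. -/
theorem Splitting.exists_lift (σ : Splitting F) (N : Components Q₁ Q₃ (fun z => F.obj (o z)))
    (K : Components Q₁ Q₂ o) :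
    ∃ X : Components Q₁ Q₂ o,
      (∀ {x y : Q₁.Obj} (p : Path x y), σ.kerProj _ _ (X.map p) = σ.kerProj _ _ (K.map p)) ∧
      X.toFormal.comp F = N.toFormal := by
  let Y : ℕ → Components Q₁ Q₂ o := fun n => (σ.correct N)^[n] K
  let X : Components Q₁ Q₂ o :=
    { map := fun p => (Y p.length).map p
      map_nil := fun x => (Y 0).map_nil x
      multilinear := fun x y a b p q => by
        have := (Y (p.length + 1 + q.length)).multilinear x y a b p q
        simpa only [Path.length_comp, Path.length_cons] using this
      map_mem := fun p d hp => (Y p.length).map_mem p d hp }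
  refine ⟨X, fun p => σ.kerProj_iterate_correct N K _ p, ?_⟩
  refine FormalMorphism.ext_map rfl fun p => heq_of_eq ?_
  refine Eq.trans ?_ (σ.iterate_correct N K p.length p le_rfl)
  have := blocks_congr (X := X) (Y := Y p.length) p fun q hq =>
    (σ.iterate_correct_stable N K q le_rfl hq).symm
  change ((blocks X.toFormal p).map F.map).sum = _
  rw [this]

end Lifting

/-! ### The A∞-structure on the fiber quiver -/

section Fiber

variable {R : Type w} [CommRing R] {Q Q' Q'' Z : GradedQuiver.{w, u, v} R}

theorem strictMap_of_length {Q₁ Q₂ : GradedQuiver.{w, u, v} R} {obj : Q₁.Obj → Q₂.Obj}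
    (f : ∀ x y : Q₁.Obj, Q₁.Hom x y →ₗ[R] Q₂.Hom (obj x) (obj y)) {x y : Q₁.Obj} (p : Path x y)
    (hp : 1 < p.length) : strictMap f p = 0 := by
  match p, hp with
  | Path.cons (Path.cons p f) g, _ => rfl

variable {F : FormalMorphism Q Q'} {G : FormalMorphism Q'' Q'}

/-- The projection of a morphism space of the fiber quiver to the kernel of `F¹`. -/
def fiberHomFst (x y : (fiberQuiver F G).Obj) :
    (fiberQuiver F G).Hom x y →ₗ[R] LinearMap.ker (F.lin x.1.1 y.1.1) :=
  LinearMap.fst R (LinearMap.ker (F.lin x.1.1 y.1.1)) (Q''.Hom x.1.2 y.1.2)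

/-- The projection of a morphism space of the fiber quiver to `Q''`. -/
def fiberHomSnd (x y : (fiberQuiver F G).Obj) :
    (fiberQuiver F G).Hom x y →ₗ[R] Q''.Hom x.1.2 y.1.2 :=
  LinearMap.snd R (LinearMap.ker (F.lin x.1.1 y.1.1)) (Q''.Hom x.1.2 y.1.2)

theorem fiberHom_ext {x y : (fiberQuiver F G).Obj} {f g : (fiberQuiver F G).Hom x y}
    (h₁ : fiberHomFst x y f = fiberHomFst x y g) (h₂ : fiberHomSnd x y f = fiberHomSnd x y g) :
    f = g :=
  Prod.ext h₁ h₂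

theorem fiberSnd_of_length {x y : (fiberQuiver F G).Obj} (p : Path x y) (hp : 1 < p.length) :
    (fiberSnd F G).map p = 0 :=
  strictMap_of_length fiberHomSnd p hp

/-- `β` is a formal morphism from the fiber quiver to `Q` whose projection to the kernel of `F¹` is
the linear projection and which makes the square with `F` and `G` commute. -/
structure IsFiberFst (σ : Splitting F) (β : Components (fiberQuiver F G) Q fun p => p.1.1) :
    Prop where
  kerProj_single : ∀ {x y : (fiberQuiver F G).Obj} (f : (fiberQuiver F G).Hom x y),
    σ.kerProj _ _ (β.map (Path.nil.cons f)) = f.1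
  kerProj_of_length : ∀ {x y : (fiberQuiver F G).Obj} (p : Path x y), 1 < p.length →
    σ.kerProj _ _ (β.map p) = 0
  comp_eq : β.toFormal.comp F = (fiberSnd F G).comp G

theorem Splitting.exists_isFiberFst (σ : Splitting F) (G : FormalMorphism Q'' Q') :
    ∃ β : Components (fiberQuiver F G) Q fun p => p.1.1, IsFiberFst σ β := by
  have h : ((fiberSnd F G).comp G).obj = fun p : (fiberQuiver F G).Obj => F.obj p.1.1 :=
    funext fun p => p.2.symm
  let k : ∀ p q : (fiberQuiver F G).Obj, (fiberQuiver F G).Hom p q →ₗ[R] Q.Hom p.1.1 q.1.1 :=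
    fun p q => (LinearMap.ker (F.lin p.1.1 q.1.1)).subtype ∘ₗ fiberHomFst p q
  let K := FormalMorphism.strict (Q₁ := fiberQuiver F G) (Q₂ := Q) (fun p => p.1.1) k
    (fun _ _ _ _ h => h.1)
  obtain ⟨β, h₁, h₂⟩ := σ.exists_lift (Components.ofFormal _ _ h)
    (Components.ofFormal K (fun p => p.1.1) rfl)
  refine ⟨β, ⟨fun f => ?_, fun {x y} p hp => ?_, ?_⟩⟩
  · rw [h₁]
    exact σ.kerProj_coe _
  · rw [h₁]
    exact (congrArg (σ.kerProj x.1.1 y.1.1) (strictMap_of_length k p hp)).trans (map_zero _)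
  · rw [h₂, Components.toFormal_ofFormal]

/-- The maps of the A∞-structure on the fiber quiver: the second component is that of `Q''`, and the
first component is forced by the requirement that `β` be an A∞-functor. -/
noncomputable def fiberMap (σ : Splitting F) (β : Components (fiberQuiver F G) Q fun p => p.1.1)
    (D : AInfStructure Q) (D'' : AInfStructure Q'') {x y : (fiberQuiver F G).Obj}
    (p : Path x y) : (fiberQuiver F G).Hom x y :=
  (σ.kerProj _ _ ((blocks β.toFormal p).map D.map).sum,
    ((blocks (fiberSnd F G) p).map D''.map).sum)

section Structure

variable {σ : Splitting F} {β : Components (fiberQuiver F G) Q fun p => p.1.1}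
  {D : AInfStructure Q} {D' : AInfStructure Q'} {D'' : AInfStructure Q''}

theorem sum_insertions_fiberSnd (σ : Splitting F)
    (β : Components (fiberQuiver F G) Q fun p => p.1.1) (D : AInfStructure Q)
    (D'' : AInfStructure Q'') {x y : (fiberQuiver F G).Obj} (p : Path x y) :
    ((insertions (fiberMap σ β D D'') p).map (fiberSnd F G).map).sum =
      ((blocks (fiberSnd F G) p).map D''.map).sum :=
  sum_insertions_of_length _ p _ fun c hc => fiberSnd_of_length c hc

/-- The map `β` is an A∞-functor. On a chain on which the functor equation is not yet known, its
defect vanishes in the kernel of `F¹` by construction, and `F¹` of it vanishes since `F · β = G · α`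
satisfies the functor equation. -/
theorem IsFiberFst.sum_insertions (hβ : IsFiberFst σ β) (hF : IsAInfFunctor D D' F)
    (hG : IsAInfFunctor D'' D' G) {x y : (fiberQuiver F G).Obj} (p : Path x y) :
    ((insertions (fiberMap σ β D D'') p).map β.map).sum =
      ((blocks β.toFormal p).map D.map).sum := by
  have hαG : ∀ {x y : (fiberQuiver F G).Obj} (p : Path x y),
      ((insertions (fiberMap σ β D D'') p).map ((fiberSnd F G).comp G).map).sum =
      ((blocks ((fiberSnd F G).comp G) p).map D'.map).sum := by
    intro x y p
    refine (sum_insertions_blocks_of_eq (D₂ := D''.map) (sum_insertions_fiberSnd σ β D D'') p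
      G.map (G.multilinear _ _)).trans ?_
    simp only [hG _ _ _]
    exact (sum_blocks_comp (fiberSnd F G) G p D'.map (D'.multilinear _ _)).symm
  rw [← hβ.comp_eq] at hαG
  induction hn : p.length using Nat.strong_induction_on generalizing x y with
  | _ n ih =>
  refine σ.ext_hom ?_ ?_
  · rw [map_list_sum, List.map_map]
    refine (sum_insertions_of_length _ p _ fun c hc => hβ.kerProj_of_length c hc).trans ?_
    exact hβ.kerProj_single _
  · have h₁ := sum_insertions_blocks (fiberMap σ β D D'') D.map β.toFormal p
      (fun q hq => ih _ (hn ▸ hq) q rfl) F.map (F.multilinear _ _)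
    have h₂ := hαG p
    rw [sum_blocks_comp β.toFormal F p D'.map (D'.multilinear _ _)] at h₂
    simp only [← hF _ _ _] at h₂
    exact sub_right_injective (h₁.trans (congrArg₂ _ h₂.symm rfl))

theorem IsFiberFst.sq_zero (hβ : IsFiberFst σ β) (hF : IsAInfFunctor D D' F)
    (hG : IsAInfFunctor D'' D' G) {x y : (fiberQuiver F G).Obj} (p : Path x y) :
    ((insertions (fiberMap σ β D D'') p).map (fiberMap σ β D D'')).sum = 0 := by
  refine fiberHom_ext ?_ ?_
  · rw [map_list_sum, List.map_map, map_zero]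
    have h := sum_insertions_blocks_of_eq (D₂ := D.map) (F := β.toFormal)
      (hβ.sum_insertions hF hG) p D.map
      (D.multilinear _ _)
    simp only [D.sq_zero] at h
    have h' := congrArg (σ.kerProj _ _) h
    rw [map_list_sum, List.map_map] at h'
    refine h'.trans ?_
    simp
  · rw [map_list_sum, List.map_map, map_zero]
    refine (sum_insertions_blocks_of_eq (D₂ := D''.map) (sum_insertions_fiberSnd σ β D D'') p
      D''.map (D''.multilinear _ _)).trans ?_
    simp only [D''.sq_zero, List.map_const', List.sum_replicate, smul_zero]
    rfl

/-- The A∞-structure on the fiber quiver. -/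
noncomputable def IsFiberFst.str (hβ : IsFiberFst σ β) (hF : IsAInfFunctor D D' F)
    (hG : IsAInfFunctor D'' D' G) : AInfStructure (fiberQuiver F G) where
  map := fiberMap σ β D D''
  multilinear x y a b p q :=
    ((σ.kerProj _ _ ∘ₗ IsLinearMap.mk' _
      (blocks_linear β.toFormal (D.multilinear _ _) a b p q)).prod
      (IsLinearMap.mk' _ (blocks_linear (fiberSnd F G) (D''.multilinear _ _) a b p q))).isLinear
  map_mem p d hp := by
    refine ⟨σ.kerProj_mem (list_sum_mem fun g hg => ?_), list_sum_mem fun g hg => ?_⟩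
    · obtain ⟨c, hc, rfl⟩ := List.mem_map.1 hg
      exact D.map_mem c d (hasDeg_blocks β.toFormal p hp c hc)
    · obtain ⟨c, hc, rfl⟩ := List.mem_map.1 hg
      exact D''.map_mem c d (hasDeg_blocks (fiberSnd F G) p hp c hc)
  sq_zero := hβ.sq_zero hF hG

end Structure

/-! ### The universal property -/

section Universal

variable {σ : Splitting F} {β : Components (fiberQuiver F G) Q fun p => p.1.1}
  {D : AInfStructure Q} {D' : AInfStructure Q'} {D'' : AInfStructure Q''}

theorem comp_fiberSnd_map (L : FormalMorphism Z (fiberQuiver F G)) {x y : Z.Obj} (p : Path x y) :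
    (L.comp (fiberSnd F G)).map p = fiberHomSnd _ _ (L.map p) := by
  cases p with
  | nil =>
    rw [L.map_nil, map_zero]
    exact (L.comp (fiberSnd F G)).map_nil x
  | cons p f =>
    exact sum_blocks_of_length L (p.cons f) (by simp) _ fun c hc => fiberSnd_of_length c hc

theorem IsFiberFst.kerProj_comp (hβ : IsFiberFst σ β) (L : FormalMorphism Z (fiberQuiver F G))
    {x y : Z.Obj} (p : Path x y) :
    σ.kerProj _ _ ((L.comp β.toFormal).map p) = fiberHomFst _ _ (L.map p) := by
  cases p with
  | nil =>
    rw [L.map_nil, map_zero]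
    exact (congrArg _ ((L.comp β.toFormal).map_nil x)).trans (map_zero _)
  | cons p f =>
    change σ.kerProj _ _ ((blocks L (p.cons f)).map β.map).sum = _
    rw [map_list_sum, List.map_map]
    exact (sum_blocks_of_length L (p.cons f) (by simp) _ fun c hc =>
      hβ.kerProj_of_length c hc).trans (hβ.kerProj_single _)

/-- The projections from the fiber quiver are jointly monic. -/
theorem IsFiberFst.hom_ext (hβ : IsFiberFst σ β) {L L' : FormalMorphism Z (fiberQuiver F G)}
    (h₁ : L.comp (fiberSnd F G) = L'.comp (fiberSnd F G))
    (h₂ : L.comp β.toFormal = L'.comp β.toFormal) : L = L' := by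
  have hobj : L.obj = L'.obj := funext fun z => Subtype.ext (Prod.ext
    (congrFun (congrArg FormalMorphism.obj h₂) z) (congrFun (congrArg FormalMorphism.obj h₁) z))
  have key : ∀ {o : Z.Obj → (fiberQuiver F G).Obj} (X Y : Components Z (fiberQuiver F G) o),
      X.toFormal.comp (fiberSnd F G) = Y.toFormal.comp (fiberSnd F G) →
      X.toFormal.comp β.toFormal = Y.toFormal.comp β.toFormal → X.toFormal = Y.toFormal := by
    intro o X Y h₁ h₂
    refine FormalMorphism.ext_map rfl fun {x y} p => heq_of_eq (fiberHom_ext ?_ ?_)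
    · rw [← hβ.kerProj_comp X.toFormal, ← hβ.kerProj_comp Y.toFormal]
      have := (FormalMorphism.mk.inj h₂).2
      have := congrFun (congrFun (congrFun (eq_of_heq this) x) y) p
      exact congrArg _ this
    · rw [← comp_fiberSnd_map X.toFormal, ← comp_fiberSnd_map Y.toFormal]
      have := (FormalMorphism.mk.inj h₁).2
      exact congrFun (congrFun (congrFun (eq_of_heq this) x) y) p
  have := key (Components.ofFormal L _ hobj) (Components.ofFormal L' _ rfl)
  simp only [Components.toFormal_ofFormal] at this
  exact this h₁ h₂

/-- The formal morphism to the fiber quiver with components the projection of `J` to the kernel of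
`F¹` and `H`. -/
def Splitting.fiberLift (σ : Splitting F) (J : FormalMorphism Z Q) (H : FormalMorphism Z Q'')
    (h : J.comp F = H.comp G) : FormalMorphism Z (fiberQuiver F G) where
  obj z := ⟨(J.obj z, H.obj z), congrFun (congrArg FormalMorphism.obj h) z⟩
  map p := (σ.kerProj _ _ (J.map p), H.map p)
  map_nil x := Prod.ext ((congrArg _ (J.map_nil x)).trans (map_zero _)) (H.map_nil x)
  multilinear x y a b p q :=
    ((σ.kerProj _ _ ∘ₗ IsLinearMap.mk' _ (J.multilinear x y a b p q)).prod
      (IsLinearMap.mk' _ (H.multilinear x y a b p q))).isLinear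
  map_mem p d hp := ⟨σ.kerProj_mem (J.map_mem p d hp), H.map_mem p d hp⟩

theorem Splitting.fiberLift_comp_fiberSnd (σ : Splitting F) (J : FormalMorphism Z Q)
    (H : FormalMorphism Z Q'') (h : J.comp F = H.comp G) :
    (σ.fiberLift J H h).comp (fiberSnd F G) = H :=
  FormalMorphism.ext_map rfl fun p => heq_of_eq (comp_fiberSnd_map (σ.fiberLift J H h) p)

theorem IsFiberFst.fiberLift_comp (hβ : IsFiberFst σ β) (J : FormalMorphism Z Q)
    (H : FormalMorphism Z Q'') (h : J.comp F = H.comp G) :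
    (σ.fiberLift J H h).comp β.toFormal = J := by
  set L := σ.fiberLift J H h with hL
  have hcomp : (L.comp β.toFormal).comp F = J.comp F := by
    rw [FormalMorphism.comp_assoc, hβ.comp_eq, ← FormalMorphism.comp_assoc,
      σ.fiberLift_comp_fiberSnd, h]
  refine FormalMorphism.ext_map rfl fun {x y} p => heq_of_eq ?_
  refine Components.ext_of_kerProj σ (X := Components.ofFormal (L.comp β.toFormal) J.obj rfl)
    (Y := Components.ofFormal J J.obj rfl) (fun p => hβ.kerProj_comp L p) (fun {x y} p => ?_) p
  have := (FormalMorphism.mk.inj hcomp).2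
  exact congrFun (congrFun (congrFun (eq_of_heq this) x) y) p

/-- A formal morphism to the fiber quiver is an A∞-functor if its projections are. -/
theorem IsFiberFst.isAInfFunctor_of_comp (hβ : IsFiberFst σ β) (hF : IsAInfFunctor D D' F)
    (hG : IsAInfFunctor D'' D' G) {E : AInfStructure Z} {L : FormalMorphism Z (fiberQuiver F G)}
    (h₁ : IsAInfFunctor E D'' (L.comp (fiberSnd F G)))
    (h₂ : IsAInfFunctor E D (L.comp β.toFormal)) : IsAInfFunctor E (hβ.str hF hG) L := by
  intro x y p
  refine fiberHom_ext ?_ ?_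
  · have h := congrArg (σ.kerProj _ _) ((h₂ x y p).trans
      (sum_blocks_comp L β.toFormal p D.map (D.multilinear _ _)))
    rw [map_list_sum, map_list_sum, List.map_map, List.map_map] at h
    rw [map_list_sum, map_list_sum, List.map_map, List.map_map]
    refine Eq.trans ?_ h
    congr 1
    exact List.map_congr_left fun q _ => (hβ.kerProj_comp L q).symm
  · have h := (h₁ x y p).trans
      (sum_blocks_comp L (fiberSnd F G) p D''.map (D''.multilinear _ _))
    rw [map_list_sum, map_list_sum, List.map_map, List.map_map]
    refine Eq.trans ?_ h
    congr 1
    exact List.map_congr_left fun q _ => (comp_fiberSnd_map L q).symm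

end Universal

end Fiber

/-! ### Strict units -/

section Units

variable {R : Type w} [CommRing R] {Q Q' Q'' Q₁ Q₂ Q₃ : GradedQuiver.{w, u, v} R}

/-- All components of `F` of arity at least `2` vanish if one of the arguments is `e`. -/
def FormalMorphism.KillsHigher (F : FormalMorphism Q₁ Q₂) {x : Q₁.Obj} (e : Q₁.Hom x x) : Prop :=
  ∀ (a b : Q₁.Obj) (p : Path a x) (q : Path x b), p.length + q.length ≠ 0 →
    F.map ((p.cons e).comp q) = 0

theorem FormalMorphism.KillsHigher.comp {F : FormalMorphism Q₁ Q₂} {G : FormalMorphism Q₂ Q₃}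
    {x : Q₁.Obj} {e : Q₁.Hom x x} (hF : F.KillsHigher e) (hG : G.KillsHigher (F.lin x x e)) :
    (F.comp G).KillsHigher e := by
  intro a b p q h
  refine (sum_blocks_marked F e hF p q G.map (G.multilinear _ _)).trans ?_
  refine List.sum_eq_zero fun m hm => ?_
  obtain ⟨c, hc, rfl⟩ := List.mem_map.1 hm
  refine List.sum_eq_zero fun m hm => ?_
  obtain ⟨d, hd, rfl⟩ := List.mem_map.1 hm
  refine hG _ _ c d ?_
  by_cases hp : p.length = 0
  · have := length_pos_of_mem_blocks F (by omega) hd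
    omega
  · have := length_pos_of_mem_blocks F hp hc
    omega

theorem FormalMorphism.lin_comp (F : FormalMorphism Q₁ Q₂) (G : FormalMorphism Q₂ Q₃)
    {x y : Q₁.Obj} (f : Q₁.Hom x y) : (F.comp G).lin x y f = G.lin _ _ (F.lin x y f) := by
  change ((blocks F (Path.nil.cons f)).map G.map).sum = _
  simp only [blocks, blocksAux, List.map_cons, List.map_nil, List.sum_cons, List.sum_nil, add_zero]
  rfl

theorem AInfStructure.IsStrictUnit.unique {D : AInfStructure Q} {x : Q.Obj} {e e' : Q.Hom x x}
    (h : D.IsStrictUnit e) (h' : D.IsStrictUnit e') : e = e' := by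
  have h₁ := h.2.2.1 x e'
  have h₂ := h'.2.2.2 x 0 e h.1
  rw [h₁] at h₂
  simpa using h₂.symm

theorem AInfStructure.IsStrictUnit.map_cons {D : AInfStructure Q} {x y : Q.Obj} {e : Q.Hom x x}
    (h : D.IsStrictUnit e) (f : Q.Hom y x) :
    D.map ((Path.nil.cons f).cons e) = -koszul Q y x f := by
  have hf : f ∈ ⨆ d, Q.deg y x d := by
    rw [(Q.isInternal y x).submodule_iSup_eq_top]
    trivial
  have hl : IsLinearMap R fun f : Q.Hom y x => D.map ((Path.nil.cons f).cons e) :=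
    D.multilinear y x y x Path.nil (Path.nil.cons e)
  induction hf using Submodule.iSup_induction' with
  | mem d f hf =>
    rw [h.2.2.2 y d f hf, koszul_of_mem hf, Int.negOnePow_sub, Int.negOnePow_one]
    simp
  | zero => rw [map_zero, neg_zero]; exact hl.map_zero
  | add f g _ _ hf hg =>
    rw [map_add, neg_add, ← hf, ← hg]
    exact hl.map_add f g

/-- A functional `ρ` which only sees the linear part of `X` does not see the terms of the functor
equation for `X` on a chain containing a unit, except on chains of length `2`. -/
theorem map_sum_blocks_unit {X : FormalMorphism Q₁ Q₂} {D : AInfStructure Q₂} {x : Q₁.Obj}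
    {e : Q₁.Hom x x} (hX : X.KillsHigher e) (he : D.IsStrictUnit (X.lin x x e)) {a b : Q₁.Obj}
    {M : Type*} [AddCommGroup M] [Module R M] (ρ : Q₂.Hom (X.obj a) (X.obj b) →ₗ[R] M)
    (hρ : ∀ c : Path a b, 1 < c.length → ρ (X.map c) = 0) (p : Path a x) (q : Path x b)
    (h : p.length + q.length ≠ 1) :
    ρ ((blocks X ((p.cons e).comp q)).map D.map).sum = 0 := by
  rw [sum_blocks_marked X e hX p q D.map (D.multilinear _ _)]
  have hnil : ∀ z : Q₁.Obj, blocks X (Path.nil : Path z z) = [Path.nil] := fun _ => rfl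
  cases q with
  | nil =>
    cases p with
    | nil =>
      simp only [hnil, List.map_cons, List.map_nil, List.sum_cons, List.sum_nil, add_zero]
      rw [he.2.1 _ _ Path.nil Path.nil (by simp), map_zero]
    | cons p f =>
      simp only [hnil, List.map_cons, List.map_nil, List.sum_cons, List.sum_nil, add_zero,
        Path.comp_nil]
      have hp : p.length ≠ 0 := by simpa using h
      rw [sum_blocks_of_length X (p.cons f) (by simp) (fun c => D.map (c.cons (X.lin x x e)))
        fun c hc => he.2.1 _ _ c Path.nil (by rw [Path.length_nil]; omega), he.map_cons,
        ← X.map_koszulPath, map_neg, hρ, neg_zero]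
      rw [length_koszulPath, Path.length_cons]
      omega
  | cons q g =>
    cases p with
    | nil =>
      have hq : q.length ≠ 0 := by simpa using h
      simp only [hnil, List.map_cons, List.map_nil, List.sum_cons, List.sum_nil, add_zero]
      rw [sum_blocks_of_length X (q.cons g) (by simp)
        (fun d => D.map ((Path.nil.cons (X.lin x x e)).comp d))
        fun d hd => he.2.1 _ _ Path.nil d (by rw [Path.length_nil]; omega)]
      refine (congrArg ρ (he.2.2.1 _ _)).trans (hρ _ ?_)
      rw [Path.length_cons]
      omega
    | cons p f =>
      rw [List.sum_eq_zero, map_zero]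
      intro m hm
      obtain ⟨c, hc, rfl⟩ := List.mem_map.1 hm
      refine List.sum_eq_zero fun m hm => ?_
      obtain ⟨d, hd, rfl⟩ := List.mem_map.1 hm
      have h₁ := length_pos_of_mem_blocks X (by simp) hc
      have h₂ := length_pos_of_mem_blocks X (by simp) hd
      exact he.2.1 _ _ c d (by omega)

theorem sum_blocks_unit_cons {X : FormalMorphism Q₁ Q₂} {D : AInfStructure Q₂} {x y : Q₁.Obj}
    {e : Q₁.Hom x x} (hX : X.KillsHigher e) (he : D.IsStrictUnit (X.lin x x e))
    (f : Q₁.Hom x y) :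
    ((blocks X ((Path.nil.cons e).cons f)).map D.map).sum = X.lin x y f := by
  refine (sum_blocks_marked X e hX Path.nil (Path.nil.cons f) D.map (D.multilinear _ _)).trans ?_
  simp only [blocks, blocksAux, List.map_cons, List.map_nil, List.sum_cons, List.sum_nil, add_zero,
    Path.comp_cons, Path.comp_nil]
  exact he.2.2.1 _ _

theorem sum_blocks_cons_unit {X : FormalMorphism Q₁ Q₂} {D : AInfStructure Q₂} {x y : Q₁.Obj}
    {e : Q₁.Hom x x} (hX : X.KillsHigher e) (he : D.IsStrictUnit (X.lin x x e)) {d : ℤ}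
    {f : Q₁.Hom y x} (hf : f ∈ Q₁.deg y x d) :
    ((blocks X ((Path.nil.cons f).cons e)).map D.map).sum = (d.negOnePow : ℤ) • X.lin y x f := by
  refine (sum_blocks_marked X e hX (Path.nil.cons f) Path.nil D.map (D.multilinear _ _)).trans ?_
  simp only [blocks, blocksAux, List.map_cons, List.map_nil, List.sum_cons, List.sum_nil, add_zero,
    Path.comp_nil]
  exact he.2.2.2 _ _ _ (X.lin_mem hf)

/-- The components on chains of length less than `n`, extended by zero. -/
def Components.truncate {o : Q₁.Obj → Q₂.Obj} (X : Components Q₁ Q₂ o) (n : ℕ) :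
    Components Q₁ Q₂ o where
  map p := if p.length < n then X.map p else 0
  map_nil x := by split_ifs <;> simp [X.map_nil]
  multilinear x y a b p q := by
    by_cases h : p.length + 1 + q.length < n
    · simpa only [Path.length_comp, Path.length_cons, h, if_true] using X.multilinear x y a b p q
    · simp only [Path.length_comp, Path.length_cons, h, if_false]
      exact (0 : Q₁.Hom a b →ₗ[R] Q₂.Hom (o x) (o y)).isLinear
  map_mem p d hp := by
    split_ifs
    · exact X.map_mem p d hp
    · exact Submodule.zero_mem _

variable {F : FormalMorphism Q Q'} {G : FormalMorphism Q'' Q'} {σ : Splitting F}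
  {β : Components (fiberQuiver F G) Q fun p => p.1.1} {D : AInfStructure Q} {D' : AInfStructure Q'}
  {D'' : AInfStructure Q''}

theorem fiberSnd_killsHigher {x : (fiberQuiver F G).Obj} (e : (fiberQuiver F G).Hom x x) :
    (fiberSnd F G).KillsHigher e := fun a b p q h =>
  fiberSnd_of_length _ (by rw [Path.length_comp, Path.length_cons]; omega)

/-- The morphism `(κ u, u'')` of the fiber quiver, where `κ` is the projection to the kernel of
`F¹`. It is a strict unit if `u` and `u''` are strict units and `F` and `G` preserve them. -/
def Splitting.fiberUnit (σ : Splitting F) (G : FormalMorphism Q'' Q') (x : (fiberQuiver F G).Obj)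
    (u : Q.Hom x.1.1 x.1.1) (u'' : Q''.Hom x.1.2 x.1.2) : (fiberQuiver F G).Hom x x :=
  (σ.kerProj _ _ u, u'')

section

variable {x : (fiberQuiver F G).Obj} {u : Q.Hom x.1.1 x.1.1}
  {u'' : Q''.Hom x.1.2 x.1.2}

theorem IsFiberFst.lin_fiberUnit (hβ : IsFiberFst σ β) (hu : D'.IsStrictUnit (F.lin _ _ u))
    (hu'' : D'.IsStrictUnit (G.lin _ _ u'')) :
    β.toFormal.lin x x (σ.fiberUnit G x u u'') = u := by
  refine σ.ext_hom (hβ.kerProj_single _) ?_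
  have h : D'.IsStrictUnit (((fiberSnd F G).comp G).lin x x (σ.fiberUnit G x u u'')) := by
    rw [FormalMorphism.lin_comp]
    exact hu''
  rw [← hβ.comp_eq, FormalMorphism.lin_comp] at h
  exact h.unique hu

/-- The higher components of `β` vanish on units. The terms of `F · β = G · α` with at least two
blocks only involve shorter components of `β`, hence the truncation. -/
theorem IsFiberFst.killsHigher (hβ : IsFiberFst σ β) (hu : D'.IsStrictUnit (F.lin _ _ u))
    (hu'' : D'.IsStrictUnit (G.lin _ _ u'')) (hF : F.KillsHigher u) (hG : G.KillsHigher u'') :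
    β.toFormal.KillsHigher (σ.fiberUnit G x u u'') := by
  set e := σ.fiberUnit G x u u''
  have hcomp : (β.toFormal.comp F).KillsHigher e := by
    rw [hβ.comp_eq]
    exact (fiberSnd_killsHigher e).comp hG
  intro a b p q h
  induction hn : p.length + 1 + q.length using Nat.strong_induction_on generalizing a b with
  | _ n ih =>
  have hlen : ((p.cons e).comp q).length = n := by
    rw [Path.length_comp, Path.length_cons, hn]
  refine σ.ext_hom ((hβ.kerProj_of_length _ (by omega)).trans (map_zero _).symm) ?_
  have hW : (β.truncate n).toFormal.KillsHigher e := by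
    intro a' b' p' q' h'
    change ite _ _ _ = _
    split_ifs with hl
    · rw [Path.length_comp, Path.length_cons] at hl
      exact ih _ hl a' b' p' q' h' rfl
    · rfl
  have he : (β.truncate n).toFormal.lin x x e = u :=
    (if_pos (by simp only [Path.length_cons, Path.length_nil]; omega)).trans
      (hβ.lin_fiberUnit hu hu'')
  have h₁ := hW.comp (he ▸ hF) a b p q h
  have h₂ : (β.truncate n).map ((p.cons e).comp q) = 0 := if_neg (by omega)
  have h₃ := lin_sub_congr (F := F) (X := β) (Y := β.truncate n) ((p.cons e).comp q)
    fun r hr => (if_pos (by omega)).symm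
  rw [h₁, h₂, hcomp a b p q h, map_zero, sub_zero, zero_sub, neg_eq_zero] at h₃
  rw [map_zero]
  exact h₃

theorem IsFiberFst.isStrictUnit (hβ : IsFiberFst σ β)
    (hFD : IsAInfFunctor D D' F) (hGD : IsAInfFunctor D'' D' G)
    (hu : D'.IsStrictUnit (F.lin _ _ u)) (hu'' : D'.IsStrictUnit (G.lin _ _ u''))
    (hF : F.KillsHigher u) (hG : G.KillsHigher u'') (hD : D.IsStrictUnit u)
    (hD'' : D''.IsStrictUnit u'') :
    (hβ.str hFD hGD).IsStrictUnit (σ.fiberUnit G x u u'') := by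
  have hk := hβ.killsHigher hu hu'' hF hG
  have he : D.IsStrictUnit (β.toFormal.lin x x (σ.fiberUnit G x u u'')) := by
    rwa [hβ.lin_fiberUnit hu hu'']
  have hk' := fiberSnd_killsHigher (σ.fiberUnit G x u u'')
  have he' : D''.IsStrictUnit ((fiberSnd F G).lin x x (σ.fiberUnit G x u u'')) := hD''
  refine ⟨⟨σ.kerProj_mem hD.1, hD''.1⟩, fun a b p q h => fiberHom_ext ?_ ?_,
    fun y f => fiberHom_ext ?_ ?_, fun y d f hf => fiberHom_ext ?_ ?_⟩
  · rw [map_zero]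
    exact map_sum_blocks_unit hk he (σ.kerProj _ _) (fun c hc => hβ.kerProj_of_length c hc) p q h
  · rw [map_zero]
    exact map_sum_blocks_unit hk' he' LinearMap.id (fun c hc => fiberSnd_of_length c hc) p q h
  · exact (congrArg (σ.kerProj _ _) (sum_blocks_unit_cons hk he f)).trans (hβ.kerProj_single f)
  · exact sum_blocks_unit_cons hk' he' f
  · rw [map_zsmul]
    exact (congrArg (σ.kerProj _ _) (sum_blocks_cons_unit hk he hf)).trans
      ((map_zsmul _ _ _).trans (congrArg _ (hβ.kerProj_single f)))
  · rw [map_zsmul]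
    exact sum_blocks_cons_unit hk' he' hf

end

end Units

/-! ### Condition (F1) -/

section F1

variable {R : Type w} [CommRing R] {Q Q₁ Q₂ Q₃ : GradedQuiver.{w, u, v} R}

theorem satisfiesF1_iff {A B : AInfCat.{w, u, v} R} (F : A ⟶ B) :
    AInfFunctor.SatisfiesF1 F ↔ Nonempty (Splitting F.toFormal) := by
  constructor
  · intro h
    choose s hs hs' using h
    exact ⟨⟨s, hs, fun x y g => LinearMap.congr_fun (hs' x y) g⟩⟩
  · rintro ⟨σ⟩ x y
    exact ⟨σ.sec x y, σ.sec_mem x y, LinearMap.ext (σ.lin_sec x y)⟩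

/-- The composition of sections of `F¹` and `G¹` is a section of `(G · F)¹`. -/
def Splitting.comp {F : FormalMorphism Q₁ Q₂} {G : FormalMorphism Q₂ Q₃} (σ : Splitting F)
    (τ : Splitting G) : Splitting (F.comp G) where
  sec x y := σ.sec x y ∘ₗ τ.sec (F.obj x) (F.obj y)
  sec_mem x y d g hg := σ.sec_mem x y d _ (τ.sec_mem _ _ d g hg)
  lin_sec x y g := by
    rw [FormalMorphism.lin_comp]
    change G.lin _ _ (F.lin x y (σ.sec x y (τ.sec _ _ g))) = g
    rw [σ.lin_sec, τ.lin_sec]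

/-- Transport of morphisms along equalities of objects. -/
def homCast {x x' y y' : Q.Obj} (hx : x' = x) (hy : y' = y) : Q.Hom x' y' →ₗ[R] Q.Hom x y :=
  hx ▸ hy ▸ LinearMap.id

theorem homCast_mem {x x' y y' : Q.Obj} (hx : x' = x) (hy : y' = y) {d : ℤ} {f : Q.Hom x' y'}
    (hf : f ∈ Q.deg x' y' d) : homCast hx hy f ∈ Q.deg x y d := by
  subst hx hy
  exact hf

theorem lin_homCast (F : FormalMorphism Q₁ Q₂) {x x' y y' : Q₁.Obj} (hx : x' = x) (hy : y' = y)
    (f : Q₁.Hom x' y') : F.lin x y (homCast hx hy f) ≍ F.lin x' y' f := by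
  subst hx hy
  rfl

theorem lin_heq_of_eq_id {E : FormalMorphism Q Q} (h : E = FormalMorphism.id Q) {x y : Q.Obj}
    (f : Q.Hom x y) : E.lin x y f ≍ f := by
  subst h
  rfl

/-- The linear part of an isomorphism splits: the section is the linear part of the inverse. -/
def Splitting.ofInverse (F : FormalMorphism Q₁ Q₂) (G : FormalMorphism Q₂ Q₁)
    (h : F.comp G = FormalMorphism.id Q₁) (h' : G.comp F = FormalMorphism.id Q₂) :
    Splitting F where
  sec x y := homCast (congrFun (congrArg FormalMorphism.obj h) x)
    (congrFun (congrArg FormalMorphism.obj h) y) ∘ₗ G.lin (F.obj x) (F.obj y)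
  sec_mem x y d g hg := homCast_mem _ _ (G.lin_mem hg)
  lin_sec x y g := by
    refine eq_of_heq ((lin_homCast F _ _ _).trans ?_)
    exact (heq_of_eq (FormalMorphism.lin_comp G F g).symm).trans (lin_heq_of_eq_id h' g)

end F1

/-! ### The pullback -/

section Pullback

variable {R : Type w} [CommRing R] {A A' A'' : AInfCat.{w, u, v} R} {F : A ⟶ A'} {G : A'' ⟶ A'}
  {σ : Splitting F.toFormal}
  {β : Components (fiberQuiver F.toFormal G.toFormal) A.quiver fun p => p.1.1}

/-- The fiber quiver as an A∞-category. -/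
@[reducible] noncomputable def IsFiberFst.cat (hβ : IsFiberFst σ β) : AInfCat.{w, u, v} R :=
  ⟨fiberQuiver F.toFormal G.toFormal, hβ.str F.isAInf G.isAInf⟩

/-- The projection to the source of `G`. -/
noncomputable def IsFiberFst.snd (hβ : IsFiberFst σ β) : hβ.cat ⟶ A'' :=
  ⟨fiberSnd F.toFormal G.toFormal, fun _ _ p => sum_insertions_fiberSnd σ β A.str A''.str p⟩

/-- The projection to the source of `F`. -/
noncomputable def IsFiberFst.fst (hβ : IsFiberFst σ β) : hβ.cat ⟶ A :=
  ⟨β.toFormal, fun _ _ p => hβ.sum_insertions F.isAInf G.isAInf p⟩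

theorem AInfFunctor.ext_toFormal {A B : AInfCat.{w, u, v} R} {F G : A ⟶ B}
    (h : F.toFormal = G.toFormal) : F = G := by
  obtain ⟨F, _⟩ := F
  obtain ⟨G, _⟩ := G
  congr 1

theorem IsFiberFst.isPullback (hβ : IsFiberFst σ β) : IsPullback hβ.snd hβ.fst G F := by
  have hlift : ∀ {Z : AInfCat.{w, u, v} R} (H : Z ⟶ A'') (J : Z ⟶ A) (_ : H ≫ G = J ≫ F),
      ∃ L : Z ⟶ hβ.cat, L ≫ hβ.snd = H ∧ L ≫ hβ.fst = J := by
    intro Z H J h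
    have h' : J.toFormal.comp F.toFormal = H.toFormal.comp G.toFormal :=
      (congrArg AInfFunctor.toFormal h).symm
    have h₁ := σ.fiberLift_comp_fiberSnd J.toFormal H.toFormal h'
    have h₂ := hβ.fiberLift_comp J.toFormal H.toFormal h'
    exact ⟨⟨σ.fiberLift J.toFormal H.toFormal h', hβ.isAInfFunctor_of_comp F.isAInf G.isAInf
      (h₁.symm ▸ H.isAInf) (h₂.symm ▸ J.isAInf)⟩, AInfFunctor.ext_toFormal h₁,
      AInfFunctor.ext_toFormal h₂⟩
  have hext : ∀ {Z : AInfCat.{w, u, v} R} (L L' : Z ⟶ hβ.cat), L ≫ hβ.snd = L' ≫ hβ.snd →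
      L ≫ hβ.fst = L' ≫ hβ.fst → L = L' := fun L L' h₁ h₂ =>
    AInfFunctor.ext_toFormal (hβ.hom_ext (congrArg AInfFunctor.toFormal h₁)
      (congrArg AInfFunctor.toFormal h₂))
  refine ⟨⟨AInfFunctor.ext_toFormal hβ.comp_eq.symm⟩, ⟨Limits.PullbackCone.IsLimit.mk _
    (fun s => (hlift s.fst s.snd s.condition).choose)
    (fun s => (hlift s.fst s.snd s.condition).choose_spec.1)
    (fun s => (hlift s.fst s.snd s.condition).choose_spec.2)
    fun s m h₁ h₂ => hext _ _ ?_ ?_⟩⟩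
  · rw [h₁, (hlift s.fst s.snd s.condition).choose_spec.1]
  · rw [h₂, (hlift s.fst s.snd s.condition).choose_spec.2]

/-- The projection `(k, a) ↦ a` has the section `a ↦ (0, a)`. -/
theorem IsFiberFst.satisfiesF1_snd (hβ : IsFiberFst σ β) : AInfFunctor.SatisfiesF1 hβ.snd :=
  fun x y => ⟨LinearMap.inr R (LinearMap.ker (F.toFormal.lin x.1.1 y.1.1)) _,
    fun _ _ hg => ⟨Submodule.zero_mem _, hg⟩, rfl⟩

theorem IsFiberFst.isFlat (hβ : IsFiberFst σ β) (hA : A.IsFlat) (hA'' : A''.IsFlat) :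
    hβ.cat.IsFlat := fun x => by
  refine fiberHom_ext ?_ ?_
  · rw [map_zero]
    change σ.kerProj _ _ ([A.str.map Path.nil].sum) = 0
    rw [hA, List.sum_singleton, map_zero]
  · rw [map_zero]
    change [A''.str.map Path.nil].sum = 0
    rw [hA'', List.sum_singleton]

/-- Pairs of strict units give strict units of the fiber quiver, which are preserved by `β`. -/
theorem IsFiberFst.isStrictUnit_fiberUnit (hβ : IsFiberFst σ β)
    (hFu : AInfFunctor.IsStrictlyUnital F) (hGu : AInfFunctor.IsStrictlyUnital G)
    {x : hβ.cat.quiver.Obj} {u : A.quiver.Hom x.1.1 x.1.1} {u'' : A''.quiver.Hom x.1.2 x.1.2}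
    (hu : A.str.IsStrictUnit u) (hu'' : A''.str.IsStrictUnit u'') :
    hβ.cat.str.IsStrictUnit (σ.fiberUnit G.toFormal x u u'') ∧
      β.toFormal.lin x x (σ.fiberUnit G.toFormal x u u'') = u ∧
      β.toFormal.KillsHigher (σ.fiberUnit G.toFormal x u u'') := by
  have hF := hFu _ u hu
  have hG := hGu _ u'' hu''
  exact ⟨hβ.isStrictUnit F.isAInf G.isAInf hF.1 hG.1 hF.2 hG.2 hu hu'',
    hβ.lin_fiberUnit hF.1 hG.1, hβ.killsHigher hF.1 hG.1 hF.2 hG.2⟩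

theorem IsFiberFst.isStrictlyUnital (hβ : IsFiberFst σ β) (hA : A.IsStrictlyUnital)
    (hA'' : A''.IsStrictlyUnital) (hFu : AInfFunctor.IsStrictlyUnital F)
    (hGu : AInfFunctor.IsStrictlyUnital G) : hβ.cat.IsStrictlyUnital := fun x => by
  obtain ⟨u, hu⟩ := hA x.1.1
  obtain ⟨u'', hu''⟩ := hA'' x.1.2
  exact ⟨_, (hβ.isStrictUnit_fiberUnit hFu hGu hu hu'').1⟩

theorem IsFiberFst.isStrictlyUnital_snd (hβ : IsFiberFst σ β) (hA : A.IsStrictlyUnital)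
    (hA'' : A''.IsStrictlyUnital) (hFu : AInfFunctor.IsStrictlyUnital F)
    (hGu : AInfFunctor.IsStrictlyUnital G) : AInfFunctor.IsStrictlyUnital hβ.snd := by
  intro x e he
  obtain ⟨u, hu⟩ := hA x.1.1
  obtain ⟨u'', hu''⟩ := hA'' x.1.2
  obtain rfl := he.unique (hβ.isStrictUnit_fiberUnit hFu hGu hu hu'').1
  exact ⟨hu'', fiberSnd_killsHigher _⟩

theorem IsFiberFst.isStrictlyUnital_fst (hβ : IsFiberFst σ β) (hA : A.IsStrictlyUnital)
    (hA'' : A''.IsStrictlyUnital) (hFu : AInfFunctor.IsStrictlyUnital F)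
    (hGu : AInfFunctor.IsStrictlyUnital G) : AInfFunctor.IsStrictlyUnital hβ.fst := by
  intro x e he
  obtain ⟨u, hu⟩ := hA x.1.1
  obtain ⟨u'', hu''⟩ := hA'' x.1.2
  obtain ⟨h₁, h₂, h₃⟩ := hβ.isStrictUnit_fiberUnit hFu hGu hu hu''
  obtain rfl := he.unique h₁
  refine ⟨?_, h₃⟩
  change A.str.IsStrictUnit (β.toFormal.lin x x _)
  rwa [h₂]

/-- An A∞-functor to the fiber quiver is strictly unital if its projections are. -/
theorem IsFiberFst.isStrictlyUnital_of_comp (hβ : IsFiberFst σ β)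
    (hFu : AInfFunctor.IsStrictlyUnital F) (hGu : AInfFunctor.IsStrictlyUnital G)
    {Z : AInfCat.{w, u, v} R} (L : Z ⟶ hβ.cat)
    (h₁ : AInfFunctor.IsStrictlyUnital (L ≫ hβ.snd))
    (h₂ : AInfFunctor.IsStrictlyUnital (L ≫ hβ.fst)) : AInfFunctor.IsStrictlyUnital L := by
  intro z e he
  obtain ⟨hu'', hk''⟩ := h₁ z e he
  obtain ⟨hu, hk⟩ := h₂ z e he
  refine ⟨?_, fun a b p q h => fiberHom_ext ?_ ?_⟩
  · have := (hβ.isStrictUnit_fiberUnit hFu hGu hu hu'').1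
    convert this using 1
    exact fiberHom_ext (hβ.kerProj_comp L.toFormal (Path.nil.cons e)).symm
      (comp_fiberSnd_map L.toFormal (Path.nil.cons e)).symm
  · rw [map_zero]
    exact (hβ.kerProj_comp L.toFormal _).symm.trans
      ((congrArg (σ.kerProj _ _) (hk a b p q h)).trans (map_zero _))
  · rw [map_zero]
    exact (comp_fiberSnd_map L.toFormal _).symm.trans (hk'' a b p q h)

theorem IsFiberFst.isPullback_ofHom (hβ : IsFiberFst σ β) (hA : A.IsStrictlyUnital)
    (hA' : A'.IsStrictlyUnital) (hA'' : A''.IsStrictlyUnital)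
    (hFu : AInfFunctor.IsStrictlyUnital F) (hGu : AInfFunctor.IsStrictlyUnital G)
    (hP : hβ.cat.IsStrictlyUnital) (hα : AInfFunctor.IsStrictlyUnital hβ.snd)
    (hβ' : AInfFunctor.IsStrictlyUnital hβ.fst) :
    IsPullback (SUAInfCat.ofHom hP hA'' hβ.snd hα) (SUAInfCat.ofHom hP hA hβ.fst hβ')
      (SUAInfCat.ofHom hA'' hA' G hGu) (SUAInfCat.ofHom hA hA' F hFu) := by
  have hp := hβ.isPullback
  have hlift : ∀ {Z : SUAInfCat.{w, u, v} R} (H : Z ⟶ ⟨A'', hA''⟩) (J : Z ⟶ ⟨A, hA⟩)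
      (_ : H ≫ SUAInfCat.ofHom hA'' hA' G hGu = J ≫ SUAInfCat.ofHom hA hA' F hFu),
      ∃ L : Z ⟶ ⟨hβ.cat, hP⟩, L ≫ SUAInfCat.ofHom hP hA'' hβ.snd hα = H ∧
        L ≫ SUAInfCat.ofHom hP hA hβ.fst hβ' = J := by
    intro Z H J h
    have h' : H.1 ≫ G = J.1 ≫ F := congrArg Subtype.val h
    have h₁ := hp.lift_fst H.1 J.1 h'
    have h₂ := hp.lift_snd H.1 J.1 h'
    exact ⟨⟨hp.lift H.1 J.1 h', hβ.isStrictlyUnital_of_comp hFu hGu _ (h₁.symm ▸ H.2)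
      (h₂.symm ▸ J.2)⟩, Subtype.ext h₁, Subtype.ext h₂⟩
  have hext : ∀ {Z : SUAInfCat.{w, u, v} R} (L L' : Z ⟶ ⟨hβ.cat, hP⟩),
      L ≫ SUAInfCat.ofHom hP hA'' hβ.snd hα = L' ≫ SUAInfCat.ofHom hP hA'' hβ.snd hα →
      L ≫ SUAInfCat.ofHom hP hA hβ.fst hβ' = L' ≫ SUAInfCat.ofHom hP hA hβ.fst hβ' → L = L' :=
    fun L L' h₁ h₂ => Subtype.ext (hp.hom_ext (congrArg Subtype.val h₁)
      (congrArg Subtype.val h₂))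
  refine ⟨⟨Subtype.ext hp.w⟩, ⟨Limits.PullbackCone.IsLimit.mk _
    (fun s => (hlift s.fst s.snd s.condition).choose)
    (fun s => (hlift s.fst s.snd s.condition).choose_spec.1)
    (fun s => (hlift s.fst s.snd s.condition).choose_spec.2)
    fun s m h₁ h₂ => hext _ _ ?_ ?_⟩⟩
  · rw [h₁, (hlift s.fst s.snd s.condition).choose_spec.1]
  · rw [h₂, (hlift s.fst s.snd s.condition).choose_spec.2]

end Pullback

end AInfinity

theorem theoremB {R : Type w} [CommRing R] {A A' A'' : AInfCat.{w, u, v} R}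
    (F : A ⟶ A') (G : A'' ⟶ A') (hF : AInfFunctor.SatisfiesF1 F) :
    -- the quiver `(K × A'')_{S'}` carries an A∞-structure making it a pullback along the projection
    (∃ (D : AInfStructure (fiberQuiver F.toFormal G.toFormal))
        (α : AInfCat.mk (fiberQuiver F.toFormal G.toFormal) D ⟶ A'')
        (β : AInfCat.mk (fiberQuiver F.toFormal G.toFormal) D ⟶ A),
      α.toFormal = fiberSnd F.toFormal G.toFormal ∧
      (∀ p : (fiberQuiver F.toFormal G.toFormal).Obj, β.toFormal.obj p = p.1.1) ∧
      IsPullback α β G F ∧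
      AInfFunctor.SatisfiesF1 α ∧
      -- the pullback of flat A∞-categories is flat
      (A.IsFlat → A''.IsFlat → (AInfCat.mk (fiberQuiver F.toFormal G.toFormal) D).IsFlat) ∧
      -- in the strictly unital case it is also a pullback of strictly unital A∞-categories
      ∀ (hA : A.IsStrictlyUnital) (hA' : A'.IsStrictlyUnital) (hA'' : A''.IsStrictlyUnital)
        (hFu : AInfFunctor.IsStrictlyUnital F) (hGu : AInfFunctor.IsStrictlyUnital G),
        ∃ (hP : (AInfCat.mk (fiberQuiver F.toFormal G.toFormal) D).IsStrictlyUnital)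
          (hα : AInfFunctor.IsStrictlyUnital α) (hβ : AInfFunctor.IsStrictlyUnital β),
          IsPullback (SUAInfCat.ofHom hP hA'' α hα) (SUAInfCat.ofHom hP hA β hβ)
            (SUAInfCat.ofHom hA'' hA' G hGu) (SUAInfCat.ofHom hA hA' F hFu)) ∧
    -- for every pullback the projection to `A''` satisfies (F1)
    (∀ (P : AInfCat.{w, u, v} R) (α : P ⟶ A'') (β : P ⟶ A),
      IsPullback α β G F → AInfFunctor.SatisfiesF1 α) := by
  obtain ⟨σ⟩ := (satisfiesF1_iff F).1 hF
  obtain ⟨β, hβ⟩ := σ.exists_isFiberFst G.toFormal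
  refine ⟨⟨hβ.str F.isAInf G.isAInf, hβ.snd, hβ.fst, rfl, fun _ => rfl, hβ.isPullback,
    hβ.satisfiesF1_snd, hβ.isFlat, fun hA hA' hA'' hFu hGu => ?_⟩, fun P α' β' h => ?_⟩
  · have hP := hβ.isStrictlyUnital hA hA'' hFu hGu
    have hα := hβ.isStrictlyUnital_snd hA hA'' hFu hGu
    have hβ' := hβ.isStrictlyUnital_fst hA hA'' hFu hGu
    exact ⟨hP, hα, hβ', hβ.isPullback_ofHom hA hA' hA'' hFu hGu hP hα hβ'⟩
  · let i := h.isoIsPullback _ _ hβ.isPullback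
    obtain ⟨τ⟩ := (satisfiesF1_iff hβ.snd).1 hβ.satisfiesF1_snd
    have hi : i.hom ≫ hβ.snd = α' := h.isoIsPullback_hom_fst _ _ hβ.isPullback
    rw [← hi, satisfiesF1_iff]
    exact ⟨(Splitting.ofInverse i.hom.toFormal i.inv.toFormal
      (congrArg AInfFunctor.toFormal i.hom_inv_id)
      (congrArg AInfFunctor.toFormal i.inv_hom_id)).comp τ⟩
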